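/- Let $-\infty\le a<b\le\infty$ and let $p,q,r$ be Lebesgue measurable and real-valued on $(a,b)$ with $p,r>0$ a.e. and $1/p,q,r\in L^1_{loc}((a,b);dx)$. For $f\in AC_{loc}((a,b))$ put $f^{[1]}=pf'$ (the continuous representative is taken if there is one). Let $\mathfrak D_\tau$ be the set of all $f\in AC_{loc}((a,b))$ with $f^{[1]}\in AC_{loc}((a,b))$, and for such $f,g$ let $\tau f=\frac1r\big[-(f^{[1]})'+qf\big]$ and $W(f,g)=fg^{[1]}-f^{[1]}g$. In $L^2((a,b);r\,dx)$, with inner product $(f,g)=\int_a^b r\,\overline f\,g\,dx$, let $T_{max}g=\tau g$ on $\operatorname{dom}(T_{max})=\{g\in L^2((a,b);r\,dx)\cap\mathfrak D_\tau : \tau g\in L^2((a,b);r\,dx)\}$, and let $T_{min}$ be the closure of the restriction of $T_{max}$ to functions with compact support in $(a,b)$. Assume that $\tau$ is in the limit circle case at $a$ (for every $z\in\mathbb C$ all solutions of $\tau u=zu$ are in $L^2((a,b);r\,dx)$ near $a$) and in the limit point case at $b$ (for every $z\in\mathbb C$ some solution of $\tau u=zu$ is not in $L^2((a,b);r\,dx)$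 near $b$), and that $T_{min}\ge\lambda_0 I$ for some $\lambda_0\in\mathbb R$. For $t\in\{a,b\}$ let $u_t$ and $\widehat u_t$ be principal and nonprincipal solutions at $t$ of $\tau u=\lambda_0u$ on $(a,b)$ with $W(\widehat u_t,u_t)=1$. Here a real-valued solution $u$ is called principal at $t$ if there is a real-valued solution $v$ with $W(u,v)=1$ and $u(x)=o(v(x))$ as $x\to t$ such that, on a one-sided neighbourhood of $t$, both $u$ and $v$ do not vanish, $1/(pu^2)$ is not integrable up to $t$, and $1/(pv^2)$ is integrable up to $t$; a real-valued solution is called nonprincipal at $t$ if it is linearly independent of the principal solution $u_t$. Let $a<a_0<b_0<b$ be such that $u_a,\widehat u_a$ have no zeros in $(a,a_0)$ and $u_b,\widehat u_b$ have no zeros in $(b_0,b)$, and let $c\in(a,a_0)$, $d\in(b_0,b)$. Put $N_uf=p^{1/2}u\,(f/u)'$, let $\operatorname{dom}(\mathfrak Q_{c,d})$ be the set of all $h\in L^2((a,b);r\,dx)\cap AC_{loc}((a,b))$ with $$p^{-1/2}h^{[1]}\in L^2((c,d);dx),\quad N_{\widehat u_a}h\in L^2((a,c);dx),\quad N_{u_b}h\in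 L^2((d,b);dx),$$ and for $f,g\in\operatorname{dom}(\mathfrak Q_{c,d})$ let $$\begin{aligned}\mathfrak Q_{c,d}(f,g)={}&\int_a^c\overline{N_{\widehat u_a}f}\,N_{\widehat u_a}g\,dx+\int_d^b\overline{N_{u_b}f}\,N_{u_b}g\,dx+\lambda_0\int_a^c r\overline fg\,dx+\lambda_0\int_d^b r\overline fg\,dx\\&+\int_c^d\Big[p^{-1}\overline{f^{[1]}}g^{[1]}+q\overline fg\Big]dx+\frac{\widehat u_a^{[1]}(c)}{\widehat u_a(c)}\overline{f(c)}g(c)-\frac{u_b^{[1]}(d)}{u_b(d)}\overline{f(d)}g(d).\end{aligned}$$ If $f\in\operatorname{dom}(\mathfrak Q_{c,d})$ and $g\in\operatorname{dom}(T_{max})$, then $g\in\operatorname{dom}(\mathfrak Q_{c,d})$, the limits $$\widetilde f(a)=\lim_{x\downarrow a}\frac{f(x)}{\widehat u_a(x)},\qquad \widetilde g^{\,\prime}(a)=\lim_{x\downarrow a}W(\widehat u_a,g)(x)$$ exist and are finite, and $$(f,T_{max}g)_{L^2((a,b);r\,dx)}=\mathfrak Q_{c,d}(f,g)+\overline{\widetilde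 f(a)}\,\widetilde g^{\,\prime}(a).$$ -/

import Mathlib

open MeasureTheory Filter Topology
open scoped ComplexConjugate

noncomputable section

namespace SturmLiouville

/-- The real points of the open interval with (possibly infinite) endpoints `a` and `b`. -/
def ivl (a b : EReal) : Set ℝ := {x : ℝ | a < (x : EReal) ∧ (x : EReal) < b}

/-- The filter of real `x ↓ a`; this is `atBot` if `a = -∞`. -/
def rightOf (a : EReal) : Filter ℝ := comap (fun x : ℝ => (x : EReal)) (𝓝[>] a)

/-- The filter of real `x ↑ b`; this is `atTop` if `b = ∞`. -/
def leftOf (b : EReal) : Filter ℝ := comap (fun x : ℝ => (x : EReal)) (𝓝[<] b)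

/-- A three-coefficient Sturm--Liouville expression
`τ = (1/r) [-(d/dx) p (d/dx) + q]` on `(a,b)` with `-∞ ≤ a < b ≤ ∞`, where `p, q, r` are
(Lebesgue) measurable, `1/p, q, r` are locally integrable and `p, r > 0` a.e. -/
structure Expr where
  a : EReal
  b : EReal
  p : ℝ → ℝ
  q : ℝ → ℝ
  r : ℝ → ℝ
  a_lt_b : a < b
  p_meas : AEMeasurable p (volume.restrict (ivl a b))
  q_meas : AEMeasurable q (volume.restrict (ivl a b))
  r_meas : AEMeasurable r (volume.restrict (ivl a b))
  p_pos : ∀ᵐ x ∂volume.restrict (ivl a b), 0 < p x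
  r_pos : ∀ᵐ x ∂volume.restrict (ivl a b), 0 < r x
  p_inv_loc : LocallyIntegrableOn (fun x => (p x)⁻¹) (ivl a b) volume
  q_loc : LocallyIntegrableOn q (ivl a b) volume
  r_loc : LocallyIntegrableOn r (ivl a b) volume

namespace Expr

variable (τ : Expr)

/-- The open interval `(a,b)`. -/
def I : Set ℝ := ivl τ.a τ.b

/-- The measure `r dx` on `(a,b)`. -/
def μ : Measure ℝ :=
  (volume.restrict τ.I).withDensity (fun x => ENNReal.ofReal (τ.r x))

/-- The inner product `(f,g) = ∫ r(x) dx conj(f(x)) g(x)` of `L²((a,b); r dx)`. -/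
def innerR (f g : ℝ → ℂ) : ℂ := ∫ x in τ.I, (τ.r x : ℂ) * (conj (f x) * g x)

/-- `f ∈ AC_loc((a,b))`: absolute continuity on every compact subinterval. -/
def ACLoc (f : ℝ → ℂ) : Prop :=
  ∀ α ∈ τ.I, ∀ β ∈ τ.I, AbsolutelyContinuousOnInterval f α β

open Classical in
/-- The quasi-derivative `f^[1] = p f'`. As `p` and `f'` are only determined a.e., the
continuous representative of `p f'` is taken whenever there is one (it is then unique on
`(a,b)`), and `p f'` itself otherwise. -/
def qd (f : ℝ → ℂ) : ℝ → ℂ :=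
  if h : ∃ F : ℝ → ℂ, ContinuousOn F τ.I ∧
      ∀ᵐ x ∂volume.restrict τ.I, F x = (τ.p x : ℂ) * deriv f x
  then h.choose
  else fun x => (τ.p x : ℂ) * deriv f x

/-- `f` belongs to `𝔇_τ((a,b))`: both `f` and `f^[1]` are in `AC_loc((a,b))`. -/
def InD (f : ℝ → ℂ) : Prop := τ.ACLoc f ∧ τ.ACLoc (τ.qd f)

/-- `τ f = (1/r) [-(f^[1])' + q f]`. -/
def apply (f : ℝ → ℂ) (x : ℝ) : ℂ :=
  (τ.r x : ℂ)⁻¹ * (-(deriv (τ.qd f) x) + (τ.q x : ℂ) * f x)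

/-- The modified Wronskian `W(f,g) = f g^[1] - f^[1] g`. -/
def W (f g : ℝ → ℂ) (x : ℝ) : ℂ := f x * τ.qd g x - τ.qd f x * g x

/-- `f ∈ L²((a,b); r dx)`. -/
def InL2 (f : ℝ → ℂ) : Prop := MemLp f 2 τ.μ

/-- `f` is in `L²((a,b); r dx)` near `a`. -/
def InL2NearA (f : ℝ → ℂ) : Prop :=
  ∃ c ∈ τ.I, τ.InL2 ((ivl τ.a (c : EReal)).indicator f)

/-- `f` is in `L²((a,b); r dx)` near `b`. -/
def InL2NearB (f : ℝ → ℂ) : Prop :=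
  ∃ c ∈ τ.I, τ.InL2 ((ivl (c : EReal) τ.b).indicator f)

/-- `g ∈ dom(T_max)`; the maximal operator acts as `T_max g = τ g`. -/
def DomTmax (g : ℝ → ℂ) : Prop := τ.InL2 g ∧ τ.InD g ∧ τ.InL2 (τ.apply g)

/-- The domain of the pre-minimal operator: elements of `dom(T_max)` with compact support
in `(a,b)`. -/
def DomPreMin (g : ℝ → ℂ) : Prop :=
  τ.DomTmax g ∧ ∃ K : Set ℝ, IsCompact K ∧ K ⊆ τ.I ∧ ∀ x ∈ τ.I, x ∉ K → g x = 0

/-- `(u, v)` is in the graph of `T_min`, the closure of the pre-minimal operator, that is,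
`u ∈ dom(T_min)` and `T_min u = v`. -/
def TminGraph (u v : ℝ → ℂ) : Prop :=
  τ.InL2 u ∧ τ.InL2 v ∧ ∃ φ : ℕ → ℝ → ℂ, (∀ n, τ.DomPreMin (φ n)) ∧
    Tendsto (fun n => eLpNorm (φ n - u) 2 τ.μ) atTop (𝓝 0) ∧
    Tendsto (fun n => eLpNorm (τ.apply (φ n) - v) 2 τ.μ) atTop (𝓝 0)

/-- `T_min ≥ λ₀ I`. (As `T_min` is symmetric, `(u, T_min u)` is real.) -/
def TminBddBelow (lam : ℝ) : Prop :=
  ∀ u v : ℝ → ℂ, τ.TminGraph u v → lam * (τ.innerR u u).re ≤ (τ.innerR u v).re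

/-- `u` is a solution of `τ u = z u` on `(a,b)`. -/
def IsSol (z : ℂ) (u : ℝ → ℂ) : Prop :=
  τ.InD u ∧ ∀ᵐ x ∂volume.restrict τ.I, τ.apply u x = z * u x

/-- `τ` is in the limit circle case at `a`. -/
def LimitCircleA : Prop := ∀ z : ℂ, ∀ u : ℝ → ℂ, τ.IsSol z u → τ.InL2NearA u

/-- `τ` is in the limit point case at `b`. -/
def LimitPointB : Prop := ∀ z : ℂ, ∃ u : ℝ → ℂ, τ.IsSol z u ∧ ¬ τ.InL2NearB u

/-- A real-valued function regarded as a complex-valued one. -/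
def cx (u : ℝ → ℝ) : ℝ → ℂ := fun x => (u x : ℂ)

/-- `u` is a principal solution of `τ u = λ u` at `a`: a real solution, nonvanishing near
`a`, that has a companion `v` with the listed properties. -/
def IsPrincipalA (lam : ℝ) (u : ℝ → ℝ) : Prop :=
  τ.IsSol lam (cx u) ∧ ∃ v : ℝ → ℝ, τ.IsSol lam (cx v) ∧
    (∀ x ∈ τ.I, τ.W (cx u) (cx v) x = 1) ∧ u =o[rightOf τ.a] v ∧
    ∃ c₀ ∈ τ.I, (∀ x ∈ τ.I, x ≤ c₀ → u x ≠ 0 ∧ v x ≠ 0) ∧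
      ∀ c ∈ τ.I, c ≤ c₀ →
        (∫⁻ x in ivl τ.a (c : EReal), ENNReal.ofReal ((τ.p x)⁻¹ * (u x ^ 2)⁻¹)) = ⊤ ∧
        (∫⁻ x in ivl τ.a (c : EReal), ENNReal.ofReal ((τ.p x)⁻¹ * (v x ^ 2)⁻¹)) < ⊤

/-- `u` is a principal solution of `τ u = λ u` at `b`. -/
def IsPrincipalB (lam : ℝ) (u : ℝ → ℝ) : Prop :=
  τ.IsSol lam (cx u) ∧ ∃ v : ℝ → ℝ, τ.IsSol lam (cx v) ∧
    (∀ x ∈ τ.I, τ.W (cx u) (cx v) x = 1) ∧ u =o[leftOf τ.b] v ∧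
    ∃ d₀ ∈ τ.I, (∀ x ∈ τ.I, d₀ ≤ x → u x ≠ 0 ∧ v x ≠ 0) ∧
      ∀ d ∈ τ.I, d₀ ≤ d →
        (∫⁻ x in ivl (d : EReal) τ.b, ENNReal.ofReal ((τ.p x)⁻¹ * (u x ^ 2)⁻¹)) = ⊤ ∧
        (∫⁻ x in ivl (d : EReal) τ.b, ENNReal.ofReal ((τ.p x)⁻¹ * (v x ^ 2)⁻¹)) < ⊤

/-- `v` is a nonprincipal solution of `τ v = λ v` (at the endpoint at which `u` is
principal): a real solution linearly independent of the principal solution `u`. -/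
def IsNonprincipal (lam : ℝ) (u v : ℝ → ℝ) : Prop :=
  τ.IsSol lam (cx v) ∧
    ∀ α β : ℝ, (∀ x ∈ τ.I, α * u x + β * v x = 0) → α = 0 ∧ β = 0

/-- The standing hypothesis: limit circle at `a`, limit point at `b`, `T_min ≥ λ₀ I`, and
`ua, va` (resp. `ub, vb`) are principal and nonprincipal solutions of `τ u = λ₀ u` at `a`
(resp. `b`) with `W(va, ua) = W(vb, ub) = 1`. -/
structure Hyp (lam : ℝ) (ua va ub vb : ℝ → ℝ) : Prop where
  limitCircle : τ.LimitCircleA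
  limitPoint : τ.LimitPointB
  bddBelow : τ.TminBddBelow lam
  principal_a : τ.IsPrincipalA lam ua
  nonprincipal_a : τ.IsNonprincipal lam ua va
  principal_b : τ.IsPrincipalB lam ub
  nonprincipal_b : τ.IsNonprincipal lam ub vb
  wronskian_a : ∀ x ∈ τ.I, τ.W (cx va) (cx ua) x = 1
  wronskian_b : ∀ x ∈ τ.I, τ.W (cx vb) (cx ub) x = 1

/-- `N_u f = p^{1/2} u (f/u)'`. -/
def N (u : ℝ → ℝ) (f : ℝ → ℂ) (x : ℝ) : ℂ :=
  (Real.sqrt (τ.p x) : ℂ) * (u x : ℂ) * deriv (fun y => f y / (u y : ℂ)) x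

/-- `h ∈ dom(𝔔_{c,d})`, with `va` the nonprincipal solution at `a` and `ub` the principal
solution at `b`. -/
def DomQ (va ub : ℝ → ℝ) (c d : ℝ) (h : ℝ → ℂ) : Prop :=
  τ.InL2 h ∧ τ.ACLoc h ∧
    MemLp (fun x => ((Real.sqrt (τ.p x))⁻¹ : ℂ) * τ.qd h x) 2
      (volume.restrict (Set.Ioo c d)) ∧
    MemLp (τ.N va h) 2 (volume.restrict (ivl τ.a (c : EReal))) ∧
    MemLp (τ.N ub h) 2 (volume.restrict (ivl (d : EReal) τ.b))

/-- The sesquilinear form `𝔔_{c,d}(f,g)`. -/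
def Q (lam : ℝ) (va ub : ℝ → ℝ) (c d : ℝ) (f g : ℝ → ℂ) : ℂ :=
  (∫ x in ivl τ.a (c : EReal), conj (τ.N va f x) * τ.N va g x)
  + (∫ x in ivl (d : EReal) τ.b, conj (τ.N ub f x) * τ.N ub g x)
  + (lam : ℂ) * (∫ x in ivl τ.a (c : EReal), (τ.r x : ℂ) * (conj (f x) * g x))
  + (lam : ℂ) * (∫ x in ivl (d : EReal) τ.b, (τ.r x : ℂ) * (conj (f x) * g x))
  + (∫ x in Set.Ioo c d,
      ((τ.p x : ℂ)⁻¹ * (conj (τ.qd f x) * τ.qd g x) + (τ.q x : ℂ) * (conj (f x) * g x)))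
  + τ.qd (cx va) c / (va c : ℂ) * (conj (f c) * g c)
  - τ.qd (cx ub) d / (ub d : ℂ) * (conj (f d) * g d)

/-- The generalized boundary value `f̃(a) = lim_{x ↓ a} f(x) / va(x)`. -/
def bv (va : ℝ → ℝ) (f : ℝ → ℂ) : ℂ :=
  limUnder (rightOf τ.a) (fun x => f x / (va x : ℂ))

/-- The generalized boundary value `g̃'(a) = W(va, g)(a) = lim_{x ↓ a} W(va, g)(x)`. -/
def bv' (va : ℝ → ℝ) (g : ℝ → ℂ) : ℂ :=
  limUnder (rightOf τ.a) (τ.W (cx va) g)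

end Expr

end SturmLiouville

end

/-! Everything rests on one factorization. For a nonvanishing real solution `u` of `τ u = λ₀ u`, the
quotient rule gives `(g/u)' = W(u,g)/(p u²)`, so `N_u g = p^{-1/2} u⁻¹ W(u,g)`, while `W(u,g)' = -r
u (τ g - λ₀ g)`. Differentiating `conj (f/u) W(u,g)` therefore yields a Green formula for `∫ conj
(N_u f) N_u g` (`integral_conj_N_mul_N`). It is used with `va` on `(a,c)` and `ub` on `(d,b)`, with
plain integration by parts on `(c,d)`. The boundary terms at `c` and `d` are exactly the point terms
of `Q`; what remains is to pass to the two endpoints.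

At `a`, the limit circle case puts `va` in L², so `W(va,g)` has an integrable derivative and a
limit. Since `(ua/va)' = 1/(p va²)` and `ua/va` is bounded, `1/(p va²)` is integrable; hence `N_va
g` is in L², and `(f/va)'`, a product of two L² functions, is integrable, so `f/va` has a limit.

At `b`, finite energy of `g` comes from the limit point case (`LimitPointB.exists_energy_le`). If
the energy diverged, `|g/u|` would be nondecreasing near `b`, so `u` would be dominated by `g` and
lie in L², and `W(u,g)` would have a limit `L`. If `L = 0`, monotonicity bounds `(g/u) W(u,g)` and
hence the energy. If `L ≠ 0`, `g/u` grows at least like a multiple of `∫ 1/(p u²)`, which puts a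
second solution in L²; then all solutions are in L². Both are impossible.

The boundary term at `b` vanishes (`boundary_term_eq_zero`) because `u` is principal: `∫ 1/(p u²)`
diverges, while `|f/u|²` grows at most linearly in it and `∫ |W(u,g)|²/(p u²)` is finite. A product
`|f/u| |W(u,g)|` bounded away from zero contradicts this. -/

namespace AbsolutelyContinuousOnInterval

/-! ### Complex-valued absolutely continuous functions -/

open Set

variable {X Y : Type*} [PseudoMetricSpace X] [PseudoMetricSpace Y] {α β : ℝ}

/-- The sums in the definition of absolute continuity scale by at most `K`. Real part, imaginary
part, conjugate and reciprocal are all instances. -/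
theorem comp_of_dist_le {f : ℝ → X} {G : ℝ → Y} (K : ℝ)
    (hf : AbsolutelyContinuousOnInterval f α β)
    (h : ∀ x ∈ uIcc α β, ∀ y ∈ uIcc α β, dist (G x) (G y) ≤ K * dist (f x) (f y)) :
    AbsolutelyContinuousOnInterval G α β := by
  unfold AbsolutelyContinuousOnInterval at hf ⊢
  refine squeeze_zero' (.of_forall fun E => Finset.sum_nonneg fun i _ => dist_nonneg) ?_
    (by simpa using hf.const_mul K)
  refine eventually_inf_principal.2 (.of_forall fun E hE => ?_)
  rw [Finset.mul_sum]
  refine Finset.sum_le_sum fun i hi => ?_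
  exact h _ (hE.1 i hi).1 _ (hE.1 i hi).2

theorem complex_re {f : ℝ → ℂ} (hf : AbsolutelyContinuousOnInterval f α β) :
    AbsolutelyContinuousOnInterval (fun x => (f x).re) α β :=
  hf.comp_of_dist_le 1 fun x _ y _ => by
    rw [one_mul, Real.dist_eq, Complex.dist_eq, ← Complex.sub_re]
    exact Complex.abs_re_le_norm _

theorem complex_im {f : ℝ → ℂ} (hf : AbsolutelyContinuousOnInterval f α β) :
    AbsolutelyContinuousOnInterval (fun x => (f x).im) α β :=
  hf.comp_of_dist_le 1 fun x _ y _ => by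
    rw [one_mul, Real.dist_eq, Complex.dist_eq, ← Complex.sub_im]
    exact Complex.abs_im_le_norm _

theorem complex_conj {f : ℝ → ℂ} (hf : AbsolutelyContinuousOnInterval f α β) :
    AbsolutelyContinuousOnInterval (fun x => conj (f x)) α β :=
  hf.comp_of_dist_le 1 fun x _ y _ => by
    rw [one_mul, Complex.dist_conj_conj]

theorem complex_inv {f : ℝ → ℂ} (hf : AbsolutelyContinuousOnInterval f α β)
    (h0 : ∀ x ∈ uIcc α β, f x ≠ 0) :
    AbsolutelyContinuousOnInterval (fun x => (f x)⁻¹) α β := by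
  have hc : ContinuousOn (fun x => (f x)⁻¹) (uIcc α β) := hf.continuousOn.inv₀ h0
  obtain ⟨C, hC⟩ := isCompact_uIcc.exists_bound_of_continuousOn hc
  refine hf.comp_of_dist_le (C * C) fun x hx y hy => ?_
  have e : (f x)⁻¹ - (f y)⁻¹ = (f x)⁻¹ * (f y)⁻¹ * (f y - f x) := by
    have := h0 x hx; have := h0 y hy; field_simp
  rw [dist_eq_norm, e, norm_mul, norm_mul, dist_comm, dist_eq_norm]
  have h1 := hC x hx
  have h2 := hC y hy
  have := (norm_nonneg _).trans h1
  gcongr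

theorem complex_mul {f g : ℝ → ℂ} (hf : AbsolutelyContinuousOnInterval f α β)
    (hg : AbsolutelyContinuousOnInterval g α β) :
    AbsolutelyContinuousOnInterval (fun x => f x * g x) α β :=
  hf.smul hg

theorem complex_ae_differentiableAt {f : ℝ → ℂ} (hf : AbsolutelyContinuousOnInterval f α β) :
    ∀ᵐ x : ℝ, x ∈ uIcc α β → DifferentiableAt ℝ f x :=
  hf.boundedVariationOn.ae_differentiableAt_of_mem_uIcc

theorem _root_.DifferentiableAt.hasDerivAt_re {f : ℝ → ℂ} {x : ℝ} (h : DifferentiableAt ℝ f x) :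
    HasDerivAt (fun y => (f y).re) (deriv f x).re x :=
  (Complex.reCLM.hasFDerivAt.comp_hasDerivAt x h.hasDerivAt)

theorem _root_.DifferentiableAt.hasDerivAt_im {f : ℝ → ℂ} {x : ℝ} (h : DifferentiableAt ℝ f x) :
    HasDerivAt (fun y => (f y).im) (deriv f x).im x :=
  (Complex.imCLM.hasFDerivAt.comp_hasDerivAt x h.hasDerivAt)

theorem complex_intervalIntegrable_deriv {f : ℝ → ℂ}
    (hf : AbsolutelyContinuousOnInterval f α β) :
    IntervalIntegrable (deriv f) volume α β := by
  have h1 := hf.complex_re.intervalIntegrable_deriv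
  have h2 := hf.complex_im.intervalIntegrable_deriv
  have h3 : IntervalIntegrable (fun x => (deriv f x).re) volume α β := by
    refine h1.congr_ae ((ae_restrict_iff' measurableSet_uIoc).2 ?_)
    filter_upwards [hf.complex_ae_differentiableAt] with x hx hx'
    exact (hx (uIoc_subset_uIcc hx')).hasDerivAt_re.deriv
  have h4 : IntervalIntegrable (fun x => (deriv f x).im) volume α β := by
    refine h2.congr_ae ((ae_restrict_iff' measurableSet_uIoc).2 ?_)
    filter_upwards [hf.complex_ae_differentiableAt] with x hx hx'
    exact (hx (uIoc_subset_uIcc hx')).hasDerivAt_im.deriv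
  rw [intervalIntegrable_iff] at *
  exact Integrable.re_im_iff.1 ⟨h3, h4⟩

theorem complex_integral_deriv_eq_sub {f : ℝ → ℂ}
    (hf : AbsolutelyContinuousOnInterval f α β) :
    ∫ x in α..β, deriv f x = f β - f α := by
  have hi := hf.complex_intervalIntegrable_deriv
  apply Complex.ext
  · have h := Complex.reCLM.intervalIntegral_comp_comm hi
    rw [Complex.reCLM_apply] at h
    rw [← h, Complex.sub_re, ← hf.complex_re.integral_deriv_eq_sub]
    refine intervalIntegral.integral_congr_ae ?_
    filter_upwards [hf.complex_ae_differentiableAt] with x hx hx'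
    exact (hx (uIoc_subset_uIcc hx')).hasDerivAt_re.deriv.symm
  · have h := Complex.imCLM.intervalIntegral_comp_comm hi
    rw [Complex.imCLM_apply] at h
    rw [← h, Complex.sub_im, ← hf.complex_im.integral_deriv_eq_sub]
    refine intervalIntegral.integral_congr_ae ?_
    filter_upwards [hf.complex_ae_differentiableAt] with x hx hx'
    exact (hx (uIoc_subset_uIcc hx')).hasDerivAt_im.deriv.symm

/-- Derivatives below are known only as a.e. formulas. Several integrability claims are obtained by
recognizing the integrand as such a derivative. -/
theorem intervalIntegrable_of_ae_deriv_eq {f f' : ℝ → ℂ}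
    (hf : AbsolutelyContinuousOnInterval f α β) (h : ∀ᵐ x, x ∈ uIcc α β → deriv f x = f' x) :
    IntervalIntegrable f' volume α β := by
  refine hf.complex_intervalIntegrable_deriv.congr_ae ((ae_restrict_iff' measurableSet_uIoc).2 ?_)
  filter_upwards [h] with x hx hx' using hx (uIoc_subset_uIcc hx')

theorem integral_eq_sub_of_ae_deriv_eq {f f' : ℝ → ℂ}
    (hf : AbsolutelyContinuousOnInterval f α β) (h : ∀ᵐ x, x ∈ uIcc α β → deriv f x = f' x) :
    ∫ x in α..β, f' x = f β - f α := by
  rw [← hf.complex_integral_deriv_eq_sub]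
  refine intervalIntegral.integral_congr_ae ?_
  filter_upwards [h] with x hx hx' using (hx (uIoc_subset_uIcc hx')).symm

end AbsolutelyContinuousOnInterval

/-! ### Quasi-derivatives, Wronskians and the operator `N` -/

namespace SturmLiouville

open Set

theorem isOpen_ivl (a b : EReal) : IsOpen (ivl a b) :=
  (isOpen_Ioo (a := a) (b := b)).preimage continuous_coe_real_ereal

theorem measurableSet_ivl (a b : EReal) : MeasurableSet (ivl a b) :=
  (isOpen_ivl a b).measurableSet

theorem ordConnected_ivl (a b : EReal) : (ivl a b).OrdConnected :=
  ⟨fun _ hx _ hy _ hz => ⟨hx.1.trans_le (EReal.coe_le_coe_iff.2 hz.1),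
    (EReal.coe_le_coe_iff.2 hz.2).trans_lt hy.2⟩⟩

theorem uIcc_subset_ivl {a b : EReal} {α β : ℝ} (hα : α ∈ ivl a b) (hβ : β ∈ ivl a b) :
    uIcc α β ⊆ ivl a b :=
  (ordConnected_ivl a b).uIcc_subset hα hβ

theorem ivl_mono {a a' b b' : EReal} (ha : a ≤ a') (hb : b' ≤ b) : ivl a' b' ⊆ ivl a b :=
  fun _ hx => ⟨ha.trans_lt hx.1, hx.2.trans_le hb⟩

namespace Expr

variable {τ : Expr}

theorem ivl_left_subset {c : ℝ} (hc : c ∈ τ.I) : ivl τ.a c ⊆ τ.I := ivl_mono le_rfl hc.2.le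

theorem ivl_right_subset {c : ℝ} (hc : c ∈ τ.I) : ivl c τ.b ⊆ τ.I := ivl_mono hc.1.le le_rfl

theorem measurableSet_I : MeasurableSet τ.I := measurableSet_ivl _ _

theorem uIcc_subset_I {α β : ℝ} (hα : α ∈ τ.I) (hβ : β ∈ τ.I) : uIcc α β ⊆ τ.I :=
  uIcc_subset_ivl hα hβ

theorem ae_restrict_I_iff {P : ℝ → Prop} :
    (∀ᵐ x ∂volume.restrict τ.I, P x) ↔ ∀ᵐ x, x ∈ τ.I → P x :=
  ae_restrict_iff' measurableSet_I

theorem ae_p_pos : ∀ᵐ x, x ∈ τ.I → 0 < τ.p x := ae_restrict_I_iff.1 τ.p_pos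

theorem ae_r_pos : ∀ᵐ x, x ∈ τ.I → 0 < τ.r x := ae_restrict_I_iff.1 τ.r_pos

/-- Intervals with rational endpoints are countably many and cover the open set `τ.I`, so the null
sets can be united. -/
theorem ae_mem_I_of_forall {P : ℝ → Prop}
    (h : ∀ α ∈ τ.I, ∀ β ∈ τ.I, ∀ᵐ x, x ∈ uIcc α β → P x) : ∀ᵐ x, x ∈ τ.I → P x := by
  have hq : ∀ᵐ x, ∀ α β : ℚ, (α : ℝ) ∈ τ.I → (β : ℝ) ∈ τ.I → x ∈ uIcc (α : ℝ) β → P x := by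
    rw [ae_all_iff]; intro α
    rw [ae_all_iff]; intro β
    by_cases hα : (α : ℝ) ∈ τ.I
    · by_cases hβ : (β : ℝ) ∈ τ.I
      · filter_upwards [h _ hα _ hβ] with x hx _ _ using hx
      · exact .of_forall fun x _ h => absurd h hβ
    · exact .of_forall fun x h => absurd h hα
  filter_upwards [hq] with x hx hxI
  obtain ⟨ε, hε, hb⟩ := Metric.isOpen_iff.1 (isOpen_ivl τ.a τ.b) x hxI
  obtain ⟨α, h1, h2⟩ := exists_rat_btwn (show x - ε < x by linarith)
  obtain ⟨β, h3, h4⟩ := exists_rat_btwn (show x < x + ε by linarith)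
  refine hx α β (hb ?_) (hb ?_) ?_
  · rw [Metric.mem_ball, Real.dist_eq, abs_lt]; constructor <;> linarith
  · rw [Metric.mem_ball, Real.dist_eq, abs_lt]; constructor <;> linarith
  · rw [mem_uIcc]; exact Or.inl ⟨h2.le, h3.le⟩

theorem ACLoc.continuousOn {f : ℝ → ℂ} (hf : τ.ACLoc f) : ContinuousOn f τ.I := by
  intro x hx
  obtain ⟨ε, hε, hb⟩ := Metric.isOpen_iff.1 (isOpen_ivl τ.a τ.b) x hx
  have h1 : x - ε / 2 ∈ τ.I := hb (by
    rw [Metric.mem_ball, Real.dist_eq, abs_lt]; constructor <;> linarith)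
  have h2 : x + ε / 2 ∈ τ.I := hb (by
    rw [Metric.mem_ball, Real.dist_eq, abs_lt]; constructor <;> linarith)
  refine ContinuousAt.continuousWithinAt ((hf _ h1 _ h2).continuousOn.continuousAt ?_)
  rw [uIcc_of_le (by linarith)]
  exact Icc_mem_nhds (by linarith) (by linarith)

theorem ACLoc.ae_differentiableAt {f : ℝ → ℂ} (hf : τ.ACLoc f) :
    ∀ᵐ x, x ∈ τ.I → DifferentiableAt ℝ f x :=
  ae_mem_I_of_forall fun α hα β hβ => (hf α hα β hβ).complex_ae_differentiableAt

theorem ACLoc.mul {f g : ℝ → ℂ} (hf : τ.ACLoc f) (hg : τ.ACLoc g) :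
    τ.ACLoc (fun x => f x * g x) :=
  fun α hα β hβ => (hf α hα β hβ).complex_mul (hg α hα β hβ)

theorem ACLoc.sub {f g : ℝ → ℂ} (hf : τ.ACLoc f) (hg : τ.ACLoc g) :
    τ.ACLoc (fun x => f x - g x) :=
  fun α hα β hβ => (hf α hα β hβ).sub (hg α hα β hβ)

theorem ACLoc.conj {f : ℝ → ℂ} (hf : τ.ACLoc f) : τ.ACLoc (fun x => conj (f x)) :=
  fun α hα β hβ => (hf α hα β hβ).complex_conj

theorem qd_ae (f : ℝ → ℂ) : ∀ᵐ x, x ∈ τ.I → τ.qd f x = (τ.p x : ℂ) * deriv f x := by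
  rw [← ae_restrict_I_iff]
  unfold qd
  split_ifs with h
  · exact h.choose_spec.2
  · exact .of_forall fun x => rfl

theorem deriv_ae_eq_qd (f : ℝ → ℂ) : ∀ᵐ x, x ∈ τ.I → deriv f x = (τ.p x : ℂ)⁻¹ * τ.qd f x := by
  filter_upwards [qd_ae (τ := τ) f, τ.ae_p_pos] with x h1 h2 hx
  have : (τ.p x : ℂ) ≠ 0 := by exact_mod_cast (h2 hx).ne'
  rw [h1 hx]; field_simp

theorem deriv_qd_ae (f : ℝ → ℂ) : ∀ᵐ x, x ∈ τ.I →
    deriv (τ.qd f) x = (τ.q x : ℂ) * f x - (τ.r x : ℂ) * τ.apply f x := by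
  filter_upwards [τ.ae_r_pos] with x h2 hx
  have : (τ.r x : ℂ) ≠ 0 := by exact_mod_cast (h2 hx).ne'
  unfold Expr.apply
  field_simp; ring

theorem InD.acLoc_W {u g : ℝ → ℂ} (hu : τ.InD u) (hg : τ.InD g) : τ.ACLoc (τ.W u g) :=
  (hu.1.mul hg.2).sub (hu.2.mul hg.1)

theorem InD.hasDerivAt_W {u g : ℝ → ℂ} (hu : τ.InD u) (hg : τ.InD g) :
    ∀ᵐ x, x ∈ τ.I → HasDerivAt (τ.W u g)
      ((τ.r x : ℂ) * (τ.apply u x * g x - u x * τ.apply g x)) x := by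
  filter_upwards [hu.1.ae_differentiableAt, hu.2.ae_differentiableAt, hg.1.ae_differentiableAt,
    hg.2.ae_differentiableAt, deriv_qd_ae (τ := τ) u, deriv_qd_ae (τ := τ) g,
    deriv_ae_eq_qd (τ := τ) u, deriv_ae_eq_qd (τ := τ) g] with x h1 h2 h3 h4 h5 h6 h7 h8 hx
  have := ((h1 hx).hasDerivAt.mul (h4 hx).hasDerivAt).sub
    ((h2 hx).hasDerivAt.mul (h3 hx).hasDerivAt)
  refine this.congr_deriv ?_
  rw [h5 hx, h6 hx, h7 hx, h8 hx]
  ring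

/-- The derivative of `W(u,g)` for a solution `u` of `τ u = z u`. -/
theorem IsSol.hasDerivAt_W {z : ℂ} {u g : ℝ → ℂ} (hu : τ.IsSol z u) (hg : τ.InD g) :
    ∀ᵐ x, x ∈ τ.I → HasDerivAt (τ.W u g)
      (-((τ.r x : ℂ) * (u x * (τ.apply g x - z * g x)))) x := by
  filter_upwards [hu.1.hasDerivAt_W hg, ae_restrict_I_iff.1 hu.2] with x h1 h2 hx
  refine (h1 hx).congr_deriv ?_
  rw [h2 hx]; ring

theorem IsSol.exists_W_eq {z : ℂ} {u v : ℝ → ℂ} (hu : τ.IsSol z u) (hv : τ.IsSol z v) :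
    ∃ κ : ℂ, ∀ x ∈ τ.I, τ.W u v x = κ := by
  by_cases hne : τ.I.Nonempty
  · obtain ⟨e, he⟩ := hne
    refine ⟨τ.W u v e, fun x hx => ?_⟩
    obtain ⟨C, hC⟩ := (hu.1.acLoc_W hv.1 e he x hx).const_of_ae_hasDerivAt_zero (by
      filter_upwards [hu.hasDerivAt_W hv.1, ae_restrict_I_iff.1 hv.2] with y h1 h2 hy
      have hy' := uIcc_subset_I he hx hy
      refine (h1 hy').congr_deriv ?_
      rw [h2 hy']; ring)
    rw [hC x right_mem_uIcc, hC e left_mem_uIcc]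
  · exact ⟨0, fun x hx => absurd ⟨x, hx⟩ hne⟩

/-- A solution is the combination of two solutions with Wronskian `1`. -/
theorem eq_comb_of_W_eq_one {u v : ℝ → ℂ} (y : ℝ → ℂ) {x : ℝ} (h : τ.W u v x = 1) :
    y x = u x * τ.W y v x - v x * τ.W y u x := by
  calc y x = y x * τ.W u v x := by rw [h, mul_one]
    _ = _ := by unfold W; ring

/-- The numerator `u g' - u' g` of the quotient rule is `W(u,g)/p`. This identity drives the whole
argument: it gives the formula for `N`, and for a second solution with Wronskian one it gives
`(v/u)' = 1/(p u²)`. -/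
theorem hasDerivAt_div {u : ℝ → ℝ} {g : ℝ → ℂ} (hu : τ.ACLoc (cx u)) (hg : τ.ACLoc g) :
    ∀ᵐ x, x ∈ τ.I → u x ≠ 0 → HasDerivAt (fun y => g y / (u y : ℂ))
      ((τ.p x : ℂ)⁻¹ * ((u x : ℂ) ^ 2)⁻¹ * τ.W (cx u) g x) x := by
  filter_upwards [hu.ae_differentiableAt, hg.ae_differentiableAt,
    deriv_ae_eq_qd (τ := τ) (cx u), deriv_ae_eq_qd (τ := τ) g] with x h1 h3 h7 h8 hx h0
  have h0' : (cx u) x ≠ 0 := by simpa [cx] using h0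
  have := (h3 hx).hasDerivAt.div (h1 hx).hasDerivAt h0'
  refine this.congr_deriv ?_
  rw [h7 hx, h8 hx]
  unfold W
  change _ = (τ.p x : ℂ)⁻¹ * ((cx u x) ^ 2)⁻¹ * _
  field_simp

theorem ACLoc.div {u : ℝ → ℝ} {g : ℝ → ℂ} (hu : τ.ACLoc (cx u)) (hg : τ.ACLoc g) {α β : ℝ}
    (hα : α ∈ τ.I) (hβ : β ∈ τ.I) (h0 : ∀ x ∈ uIcc α β, u x ≠ 0) :
    AbsolutelyContinuousOnInterval (fun y => g y / (u y : ℂ)) α β := by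
  have := (hg α hα β hβ).complex_mul ((hu α hα β hβ).complex_inv fun x hx => by
    simpa [cx] using h0 x hx)
  simpa only [div_eq_mul_inv, cx] using this

theorem intervalIntegrable_p_inv {α β : ℝ} (hα : α ∈ τ.I) (hβ : β ∈ τ.I) :
    IntervalIntegrable (fun x => (τ.p x)⁻¹) volume α β :=
  ((τ.p_inv_loc.mono_set (uIcc_subset_I hα hβ)).integrableOn_isCompact isCompact_uIcc
    ).intervalIntegrable

theorem intervalIntegrable_q {α β : ℝ} (hα : α ∈ τ.I) (hβ : β ∈ τ.I) :
    IntervalIntegrable τ.q volume α β :=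
  ((τ.q_loc.mono_set (uIcc_subset_I hα hβ)).integrableOn_isCompact isCompact_uIcc
    ).intervalIntegrable

theorem N_ae_eq {u : ℝ → ℝ} {g : ℝ → ℂ} (hu : τ.ACLoc (cx u)) (hg : τ.ACLoc g) :
    ∀ᵐ x, x ∈ τ.I → u x ≠ 0 →
      τ.N u g x = ((Real.sqrt (τ.p x))⁻¹ : ℂ) * (u x : ℂ)⁻¹ * τ.W (cx u) g x := by
  filter_upwards [hasDerivAt_div hu hg, τ.ae_p_pos] with x h1 h2 hx h0
  have h3 : ((Real.sqrt (τ.p x) : ℝ) : ℂ) ≠ 0 := by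
    exact_mod_cast (Real.sqrt_pos.2 (h2 hx)).ne'
  have h4 : (τ.p x : ℂ) = (Real.sqrt (τ.p x) : ℂ) ^ 2 := by
    rw [← Complex.ofReal_pow, Real.sq_sqrt (h2 hx).le]
  have h5 : (u x : ℂ) ≠ 0 := by exact_mod_cast h0
  unfold N
  rw [(h1 hx h0).deriv, h4]
  field_simp

theorem norm_N_sq_ae_eq {u : ℝ → ℝ} {g : ℝ → ℂ} (hu : τ.ACLoc (cx u)) (hg : τ.ACLoc g) :
    ∀ᵐ x, x ∈ τ.I → u x ≠ 0 →
      ‖τ.N u g x‖ ^ 2 = (τ.p x)⁻¹ * (u x ^ 2)⁻¹ * ‖τ.W (cx u) g x‖ ^ 2 := by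
  filter_upwards [N_ae_eq hu hg, τ.ae_p_pos] with x h1 h2 hx h0
  rw [h1 hx h0, norm_mul, norm_mul, norm_inv, norm_inv, mul_pow, mul_pow, inv_pow, inv_pow,
    Complex.norm_real, Complex.norm_real, Real.norm_eq_abs, Real.norm_eq_abs, sq_abs, sq_abs,
    Real.sq_sqrt (h2 hx).le]

/-- `conj (f/u)' W(u,g) = conj (N_u f) N_u g`. -/
theorem conj_N_mul_N_ae_eq {u : ℝ → ℝ} {f g : ℝ → ℂ} (hu : τ.ACLoc (cx u)) (hg : τ.ACLoc g) :
    ∀ᵐ x, x ∈ τ.I → u x ≠ 0 → conj (τ.N u f x) * τ.N u g x =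
      conj (deriv (fun y => f y / (u y : ℂ)) x) * τ.W (cx u) g x := by
  filter_upwards [N_ae_eq hu hg, τ.ae_p_pos] with x h1 h2 hx h0
  have h3 : ((Real.sqrt (τ.p x) : ℝ) : ℂ) ≠ 0 := by
    exact_mod_cast (Real.sqrt_pos.2 (h2 hx)).ne'
  have h5 : (u x : ℂ) ≠ 0 := by exact_mod_cast h0
  rw [h1 hx h0]
  unfold N
  simp only [map_mul, Complex.conj_ofReal]
  field_simp

/-- `deriv` of an arbitrary function is measurable, so no regularity of `f` is needed. -/
theorem aestronglyMeasurable_N {u : ℝ → ℝ} (hu : τ.ACLoc (cx u)) (f : ℝ → ℂ) {s : Set ℝ}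
    (hs : s ⊆ τ.I) : AEStronglyMeasurable (τ.N u f) (volume.restrict s) := by
  refine AEStronglyMeasurable.mono_set hs ?_
  have h1 : AEMeasurable (fun x => (Real.sqrt (τ.p x) : ℂ)) (volume.restrict τ.I) :=
    Complex.measurable_ofReal.comp_aemeasurable
      (Real.continuous_sqrt.measurable.comp_aemeasurable τ.p_meas)
  have h2 : AEStronglyMeasurable (fun x => (u x : ℂ)) (volume.restrict τ.I) :=
    hu.continuousOn.aestronglyMeasurable measurableSet_I
  exact (h1.aestronglyMeasurable.mul h2).mul (measurable_deriv _).aestronglyMeasurable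

/-! ### Green's formulas on compact intervals -/

section Identities

variable {z : ℂ} {u : ℝ → ℝ} {f g : ℝ → ℂ} {α β : ℝ}

theorem intervalIntegrable_conj_N_mul_N (hu : τ.InD (cx u)) (hf : τ.ACLoc f) (hg : τ.InD g)
    (hα : α ∈ τ.I) (hβ : β ∈ τ.I) (h0 : ∀ x ∈ uIcc α β, u x ≠ 0) :
    IntervalIntegrable (fun x => conj (τ.N u f x) * τ.N u g x) volume α β := by
  have h1 : IntervalIntegrable (fun x => conj (deriv (fun y => f y / (u y : ℂ)) x)) volume α β := by
    refine (ACLoc.div hu.1 hf hα hβ h0).complex_conj.intervalIntegrable_of_ae_deriv_eq ?_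
    filter_upwards [hasDerivAt_div hu.1 hf] with x hx hx'
    have := (hx (uIcc_subset_I hα hβ hx') (h0 x hx'))
    rw [this.deriv]
    exact (this.star).deriv
  have h2 := h1.mul_continuousOn
    ((hu.acLoc_W hg).continuousOn.mono (uIcc_subset_I hα hβ))
  refine h2.congr_ae ((ae_restrict_iff' measurableSet_uIoc).2 ?_)
  filter_upwards [conj_N_mul_N_ae_eq (f := f) hu.1 hg.1] with x hx hx'
  have hx'' := uIoc_subset_uIcc hx'
  exact (hx (uIcc_subset_I hα hβ hx'') (h0 x hx'')).symm

theorem hasDerivAt_conj_div_mul_W (hu : τ.IsSol z (cx u)) (hf : τ.ACLoc f) (hg : τ.InD g) :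
    ∀ᵐ x, x ∈ τ.I → u x ≠ 0 →
      HasDerivAt (fun y => conj (f y / (u y : ℂ)) * τ.W (cx u) g y)
        (conj (τ.N u f x) * τ.N u g x
          - (τ.r x : ℂ) * (conj (f x) * (τ.apply g x - z * g x))) x := by
  filter_upwards [hasDerivAt_div hu.1.1 hf, hu.hasDerivAt_W hg,
    conj_N_mul_N_ae_eq (f := f) hu.1.1 hg.1] with x h1 h2 h3 hx h0
  have h4 := (h1 hx h0).star.mul (h2 hx)
  refine h4.congr_deriv ?_
  rw [h3 hx h0, (h1 hx h0).deriv]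
  have h5 : (u x : ℂ) ≠ 0 := by exact_mod_cast h0
  simp only [map_mul, map_div₀, Complex.conj_ofReal, RCLike.star_def, cx, map_inv₀, map_pow]
  field_simp
  ring

/-- The integrand is the difference of two integrable functions: `conj (N f) * N g` and the
derivative of the absolutely continuous `conj (f/u) W(u,g)`. No L² bound is involved. -/
theorem intervalIntegrable_r_conj_mul (hu : τ.IsSol z (cx u)) (hf : τ.ACLoc f) (hg : τ.InD g)
    (hα : α ∈ τ.I) (hβ : β ∈ τ.I) (h0 : ∀ x ∈ uIcc α β, u x ≠ 0) :
    IntervalIntegrable (fun x => (τ.r x : ℂ) * (conj (f x) * (τ.apply g x - z * g x)))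
      volume α β := by
  have h1 := intervalIntegrable_conj_N_mul_N hu.1 hf hg hα hβ h0
  have h2 := ((ACLoc.div hu.1.1 hf hα hβ h0).complex_conj.complex_mul
    (hu.1.acLoc_W hg α hα β hβ)).intervalIntegrable_of_ae_deriv_eq (f' := fun x =>
      conj (τ.N u f x) * τ.N u g x - (τ.r x : ℂ) * (conj (f x) * (τ.apply g x - z * g x))) (by
    filter_upwards [hasDerivAt_conj_div_mul_W hu hf hg] with x hx hx'
    exact (hx (uIcc_subset_I hα hβ hx') (h0 x hx')).deriv)
  simpa using h1.sub h2

/-- Green's formula for the factorized expression on a compact interval. -/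
theorem integral_conj_N_mul_N (hu : τ.IsSol z (cx u)) (hf : τ.ACLoc f) (hg : τ.InD g)
    (hα : α ∈ τ.I) (hβ : β ∈ τ.I) (h0 : ∀ x ∈ uIcc α β, u x ≠ 0) :
    ∫ x in α..β, conj (τ.N u f x) * τ.N u g x =
      conj (f β / (u β : ℂ)) * τ.W (cx u) g β - conj (f α / (u α : ℂ)) * τ.W (cx u) g α
      + ∫ x in α..β, (τ.r x : ℂ) * (conj (f x) * (τ.apply g x - z * g x)) := by
  have h2 := ((ACLoc.div hu.1.1 hf hα hβ h0).complex_conj.complex_mul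
    (hu.1.acLoc_W hg α hα β hβ)).integral_eq_sub_of_ae_deriv_eq (f' := fun x =>
      conj (τ.N u f x) * τ.N u g x - (τ.r x : ℂ) * (conj (f x) * (τ.apply g x - z * g x))) (by
    filter_upwards [hasDerivAt_conj_div_mul_W hu hf hg] with x hx hx'
    exact (hx (uIcc_subset_I hα hβ hx') (h0 x hx')).deriv)
  rw [intervalIntegral.integral_sub (intervalIntegrable_conj_N_mul_N hu.1 hf hg hα hβ h0)
    (intervalIntegrable_r_conj_mul hu hf hg hα hβ h0)] at h2
  rw [← h2]; ring

/-- Integration by parts on a compact interval. -/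
theorem integral_r_conj_mul_apply (hf : τ.ACLoc f) (hg : τ.InD g)
    (hα : α ∈ τ.I) (hβ : β ∈ τ.I) :
    ∫ x in α..β, (τ.r x : ℂ) * (conj (f x) * τ.apply g x) =
      (∫ x in α..β, ((τ.p x : ℂ)⁻¹ * (conj (τ.qd f x) * τ.qd g x)
        + (τ.q x : ℂ) * (conj (f x) * g x)))
      - (conj (f β) * τ.qd g β - conj (f α) * τ.qd g α) := by
  have hsub := uIcc_subset_I hα hβ
  have hd : ∀ᵐ x, x ∈ uIcc α β → deriv (fun y => conj (f y) * τ.qd g y) x =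
      ((τ.p x : ℂ)⁻¹ * (conj (τ.qd f x) * τ.qd g x) + (τ.q x : ℂ) * (conj (f x) * g x))
        - (τ.r x : ℂ) * (conj (f x) * τ.apply g x) := by
    filter_upwards [hf.ae_differentiableAt, hg.2.ae_differentiableAt, deriv_ae_eq_qd (τ := τ) f,
      deriv_qd_ae (τ := τ) g] with x h1 h2 h3 h4 hx
    have := ((h1 (hsub hx)).hasDerivAt.star.mul (h2 (hsub hx)).hasDerivAt).deriv
    refine this.trans ?_
    rw [h3 (hsub hx), h4 (hsub hx)]
    simp only [map_mul, Complex.conj_ofReal, RCLike.star_def, map_inv₀]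
    ring
  have hac := (hf.conj α hα β hβ).complex_mul (hg.2 α hα β hβ)
  have h1 := hac.integral_eq_sub_of_ae_deriv_eq hd
  have hi := hac.intervalIntegrable_of_ae_deriv_eq hd
  have h2 : IntervalIntegrable (fun x => (τ.p x : ℂ)⁻¹ * (conj (τ.qd f x) * τ.qd g x)
      + (τ.q x : ℂ) * (conj (f x) * g x)) volume α β := by
    have hq : IntervalIntegrable (fun x => (τ.q x : ℂ)) volume α β :=
      ⟨(intervalIntegrable_q hα hβ).1.ofReal, (intervalIntegrable_q hα hβ).2.ofReal⟩
    have hq' := hq.mul_continuousOn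
      ((hf.conj.continuousOn.mul hg.1.continuousOn).mono hsub)
    have hp : IntervalIntegrable (fun x => (τ.p x : ℂ)⁻¹ * (conj (τ.qd f x) * τ.qd g x))
        volume α β := by
      have h3 := (hf.conj α hα β hβ).complex_intervalIntegrable_deriv.mul_continuousOn
        (hg.2.continuousOn.mono hsub)
      refine h3.congr_ae ((ae_restrict_iff' measurableSet_uIoc).2 ?_)
      filter_upwards [hf.ae_differentiableAt, deriv_ae_eq_qd (τ := τ) f] with x h1 h3 hx
      have hx' := hsub (uIoc_subset_uIcc hx)
      have := (h1 hx').hasDerivAt.star.deriv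
      rw [show deriv (fun y => conj (f y)) x = star (deriv f x) from this, h3 hx']
      simp only [map_mul, Complex.conj_ofReal, RCLike.star_def, map_inv₀]
      ring
    exact hp.add hq'
  have h3 : IntervalIntegrable (fun x => (τ.r x : ℂ) * (conj (f x) * τ.apply g x))
      volume α β := by simpa using h2.sub hi
  rw [intervalIntegral.integral_sub h2 h3] at h1
  rw [← h1]; ring

end Identities

end Expr

end SturmLiouville

namespace SturmLiouville

open Set

/-! ### Limits and improper integrals at endpoints in `EReal` -/

section Filters

variable {a b : EReal}

theorem eventually_rightOf (hab : a < b) {P : ℝ → Prop} :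
    (∀ᶠ x in rightOf a, P x) ↔ ∃ c ∈ ivl a b, ∀ x ∈ ivl a (c : EReal), P x := by
  constructor
  · intro h
    obtain ⟨t, ht, hP⟩ := mem_comap.1 h
    obtain ⟨e, he, hsub⟩ := (nhdsGT_basis_of_exists_gt ⟨b, hab⟩).mem_iff.1 ht
    obtain ⟨c, h1, h2⟩ := EReal.lt_iff_exists_real_btwn.1 (lt_min he hab)
    refine ⟨c, ⟨h1, h2.trans_le (min_le_right _ _)⟩, fun x hx => hP ?_⟩
    exact hsub ⟨hx.1, hx.2.trans (h2.trans_le (min_le_left _ _))⟩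
  · rintro ⟨c, hc, h⟩
    exact mem_of_superset (preimage_mem_comap (Ioo_mem_nhdsGT hc.1)) h

theorem eventually_leftOf (hab : a < b) {P : ℝ → Prop} :
    (∀ᶠ x in leftOf b, P x) ↔ ∃ c ∈ ivl a b, ∀ x ∈ ivl (c : EReal) b, P x := by
  constructor
  · intro h
    obtain ⟨t, ht, hP⟩ := mem_comap.1 h
    obtain ⟨e, he, hsub⟩ := (nhdsLT_basis_of_exists_lt ⟨a, hab⟩).mem_iff.1 ht
    obtain ⟨c, h1, h2⟩ := EReal.lt_iff_exists_real_btwn.1 (max_lt he hab)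
    refine ⟨c, ⟨(le_max_right _ _).trans_lt h1, h2⟩, fun x hx => hP ?_⟩
    exact hsub ⟨((le_max_left _ _).trans_lt h1).trans hx.1, hx.2⟩
  · rintro ⟨c, hc, h⟩
    exact mem_of_superset (preimage_mem_comap (Ioo_mem_nhdsLT hc.2)) h

theorem neBot_rightOf (hab : a < b) : (rightOf a).NeBot := by
  refine ⟨fun h => ?_⟩
  obtain ⟨c, hc, h⟩ := (eventually_rightOf hab (P := fun _ => False)).1 (by rw [h]; trivial)
  obtain ⟨x, h1, h2⟩ := EReal.lt_iff_exists_real_btwn.1 hc.1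
  exact h x ⟨h1, h2⟩

theorem neBot_leftOf (hab : a < b) : (leftOf b).NeBot := by
  refine ⟨fun h => ?_⟩
  obtain ⟨c, hc, h⟩ := (eventually_leftOf hab (P := fun _ => False)).1 (by rw [h]; trivial)
  obtain ⟨x, h1, h2⟩ := EReal.lt_iff_exists_real_btwn.1 hc.2
  exact h x ⟨h1, h2⟩

theorem eventually_mem_rightOf {c : ℝ} (hc : a < c) : ∀ᶠ x in rightOf a, x ∈ ivl a (c : EReal) :=
  preimage_mem_comap (Ioo_mem_nhdsGT hc)

theorem eventually_mem_leftOf {c : ℝ} (hc : c < b) : ∀ᶠ x in leftOf b, x ∈ ivl (c : EReal) b :=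
  preimage_mem_comap (Ioo_mem_nhdsLT hc)

instance : (rightOf a).IsCountablyGenerated := by unfold rightOf; infer_instance

instance : (leftOf b).IsCountablyGenerated := by unfold leftOf; infer_instance

theorem aecover_rightOf (a : EReal) (c : ℝ) :
    AECover (volume.restrict (ivl a (c : EReal))) (rightOf a) (fun y => Ioo y c) := by
  refine aecover_restrict_of_ae_imp (measurableSet_ivl _ _) (.of_forall fun x hx => ?_)
    fun _ => measurableSet_Ioo
  filter_upwards [eventually_mem_rightOf hx.1] with y hy
  exact ⟨EReal.coe_lt_coe_iff.1 hy.2, EReal.coe_lt_coe_iff.1 hx.2⟩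

theorem aecover_leftOf (b : EReal) (d : ℝ) :
    AECover (volume.restrict (ivl (d : EReal) b)) (leftOf b) (fun y => Ioo d y) := by
  refine aecover_restrict_of_ae_imp (measurableSet_ivl _ _) (.of_forall fun x hx => ?_)
    fun _ => measurableSet_Ioo
  filter_upwards [eventually_mem_leftOf hx.2] with y hy
  exact ⟨EReal.coe_lt_coe_iff.1 hx.1, EReal.coe_lt_coe_iff.1 hy.1⟩

theorem Ioo_subset_ivl_left {c y : ℝ} (hy : y ∈ ivl a (c : EReal)) :
    Ioo y c ⊆ ivl a (c : EReal) :=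
  fun _ hx => ⟨hy.1.trans (EReal.coe_lt_coe_iff.2 hx.1), EReal.coe_lt_coe_iff.2 hx.2⟩

theorem Ioo_subset_ivl_right {d y : ℝ} (hy : y ∈ ivl (d : EReal) b) :
    Ioo d y ⊆ ivl (d : EReal) b :=
  fun _ hx => ⟨EReal.coe_lt_coe_iff.2 hx.1, (EReal.coe_lt_coe_iff.2 hx.2).trans hy.2⟩

variable {E : Type*} [NormedAddCommGroup E] {F : ℝ → E}

theorem setIntegral_Ioo_left [NormedSpace ℝ E] {c y : ℝ} (hy : y ∈ ivl a (c : EReal)) (F : ℝ → E) :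
    ∫ x in Ioo y c, F x ∂volume.restrict (ivl a (c : EReal)) = ∫ x in y..c, F x := by
  rw [Measure.restrict_restrict_of_subset (Ioo_subset_ivl_left hy),
    intervalIntegral.integral_of_le (EReal.coe_lt_coe_iff.1 hy.2).le, integral_Ioc_eq_integral_Ioo]

theorem setIntegral_Ioo_right [NormedSpace ℝ E] {d y : ℝ} (hy : y ∈ ivl (d : EReal) b) (F : ℝ → E) :
    ∫ x in Ioo d y, F x ∂volume.restrict (ivl (d : EReal) b) = ∫ x in d..y, F x := by
  rw [Measure.restrict_restrict_of_subset (Ioo_subset_ivl_right hy),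
    intervalIntegral.integral_of_le (EReal.coe_lt_coe_iff.1 hy.1).le, integral_Ioc_eq_integral_Ioo]

theorem tendsto_integral_rightOf [NormedSpace ℝ E] {c : ℝ} (hc : a < c)
    (hF : IntegrableOn F (ivl a (c : EReal))) :
    Tendsto (fun y => ∫ x in y..c, F x) (rightOf a) (𝓝 (∫ x in ivl a (c : EReal), F x)) := by
  refine ((aecover_rightOf a c).integral_tendsto_of_countably_generated hF).congr' ?_
  filter_upwards [eventually_mem_rightOf hc] with y hy using setIntegral_Ioo_left hy F

theorem tendsto_integral_leftOf [NormedSpace ℝ E] {d : ℝ} (hd : d < b)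
    (hF : IntegrableOn F (ivl (d : EReal) b)) :
    Tendsto (fun y => ∫ x in d..y, F x) (leftOf b) (𝓝 (∫ x in ivl (d : EReal) b, F x)) := by
  refine ((aecover_leftOf b d).integral_tendsto_of_countably_generated hF).congr' ?_
  filter_upwards [eventually_mem_leftOf hd] with y hy using setIntegral_Ioo_right hy F

theorem integrableOn_left_of_bounded {c : ℝ} (hc : a < c) (M : ℝ)
    (hi : ∀ y ∈ ivl a (c : EReal), IntervalIntegrable F volume y c)
    (hM : ∀ᶠ y in rightOf a, ∫ x in y..c, ‖F x‖ ≤ M) :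
    IntegrableOn F (ivl a (c : EReal)) := by
  have := neBot_rightOf hc
  obtain ⟨s, hs⟩ := (rightOf a).exists_seq_tendsto
  -- Shifting the sequence by `n₀` makes membership and the norm bound hold at every index, as the
  -- covering criterion is applied with integrability on every covering set.
  obtain ⟨n₀, hn₀⟩ := eventually_atTop.1 (hs.eventually ((eventually_mem_rightOf hc).and hM))
  have hcov := (aecover_rightOf a c).comp_tendsto (hs.comp (tendsto_add_atTop_nat n₀))
  have hmem : ∀ n, s (n + n₀) ∈ ivl a (c : EReal) := fun n => (hn₀ _ (by omega)).1
  refine hcov.integrable_of_integral_norm_bounded M (fun n => ?_) (.of_forall fun n => ?_)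
  · change Integrable F ((volume.restrict _).restrict (Ioo (s (n + n₀)) c))
    rw [Measure.restrict_restrict_of_subset (Ioo_subset_ivl_left (hmem n))]
    exact (hi _ (hmem n)).1.mono_set Ioo_subset_Ioc_self
  · exact (setIntegral_Ioo_left (hmem n) _).trans_le (hn₀ _ (by omega)).2

theorem integrableOn_right_of_bounded {d : ℝ} (hd : d < b) (M : ℝ)
    (hi : ∀ y ∈ ivl (d : EReal) b, IntervalIntegrable F volume d y)
    (hM : ∀ᶠ y in leftOf b, ∫ x in d..y, ‖F x‖ ≤ M) :
    IntegrableOn F (ivl (d : EReal) b) := by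
  have := neBot_leftOf hd
  obtain ⟨s, hs⟩ := (leftOf b).exists_seq_tendsto
  obtain ⟨n₀, hn₀⟩ := eventually_atTop.1 (hs.eventually ((eventually_mem_leftOf hd).and hM))
  have hcov := (aecover_leftOf b d).comp_tendsto (hs.comp (tendsto_add_atTop_nat n₀))
  have hmem : ∀ n, s (n + n₀) ∈ ivl (d : EReal) b := fun n => (hn₀ _ (by omega)).1
  refine hcov.integrable_of_integral_norm_bounded M (fun n => ?_) (.of_forall fun n => ?_)
  · change Integrable F ((volume.restrict _).restrict (Ioo d (s (n + n₀))))
    rw [Measure.restrict_restrict_of_subset (Ioo_subset_ivl_right (hmem n))]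
    exact (hi _ (hmem n)).1.mono_set Ioo_subset_Ioc_self
  · exact (setIntegral_Ioo_right (hmem n) _).trans_le (hn₀ _ (by omega)).2

theorem intervalIntegral_le_of_integrableOn_right {d : ℝ} {F : ℝ → ℝ} (h0 : ∀ x, 0 ≤ F x)
    (hF : IntegrableOn F (ivl (d : EReal) b)) {y z : ℝ} (hdy : d ≤ y) (hyz : y ≤ z)
    (hz : z < b) : ∫ x in y..z, F x ≤ ∫ x in ivl (d : EReal) b, F x := by
  rw [intervalIntegral.integral_of_le hyz]
  refine setIntegral_mono_set hF (.of_forall h0) (LE.le.eventuallyLE ?_)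
  exact fun x hx => ⟨EReal.coe_lt_coe_iff.2 (hdy.trans_lt hx.1),
    (EReal.coe_le_coe_iff.2 hx.2).trans_lt hz⟩

end Filters

/-! ### Square integrability and estimates for quotients by solutions -/

namespace Expr

variable {τ : Expr}

theorem InL2.integrableOn {f g : ℝ → ℂ} (hf : τ.InL2 f) (hg : τ.InL2 g) :
    IntegrableOn (fun x => (τ.r x : ℂ) * (conj (f x) * g x)) τ.I := by
  have h1 : Integrable (fun x => conj (f x) * g x) τ.μ :=
    MemLp.integrable_mul (p := 2) (q := 2) hf.star hg
  have h2 := (integrable_withDensity_iff_integrable_smul₀' τ.r_meas.ennreal_ofReal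
    (.of_forall fun x => ENNReal.ofReal_lt_top)).1 h1
  refine h2.congr ?_
  filter_upwards [τ.r_pos] with x hx
  rw [ENNReal.toReal_ofReal hx.le, Complex.real_smul]

theorem InL2.integrableOn_of_indicator {f g : ℝ → ℂ} {s : Set ℝ} (hs : MeasurableSet s)
    (hsI : s ⊆ τ.I) (hf : τ.InL2 (s.indicator f)) (hg : τ.InL2 g) :
    IntegrableOn (fun x => (τ.r x : ℂ) * (conj (f x) * g x)) s := by
  refine ((hf.integrableOn hg).mono_set hsI).congr_fun (fun x hx => ?_) hs
  simp only [indicator_of_mem hx]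

theorem InL2.indicator {f : ℝ → ℂ} {s : Set ℝ} (hs : MeasurableSet s) (hf : τ.InL2 f) :
    τ.InL2 (s.indicator f) :=
  MemLp.indicator hs hf

theorem InL2.indicator_mono {f : ℝ → ℂ} {s t : Set ℝ} (hs : MeasurableSet s) (hst : s ⊆ t)
    (hf : τ.InL2 (t.indicator f)) : τ.InL2 (s.indicator f) := by
  have := InL2.indicator hs hf
  rwa [indicator_indicator, inter_eq_left.2 hst] at this

theorem DomTmax.inL2_sub {g : ℝ → ℂ} (hg : τ.DomTmax g) (z : ℂ) :
    τ.InL2 (fun x => τ.apply g x - z * g x) :=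
  hg.2.2.sub (MemLp.const_mul hg.1 z)

theorem InL2.of_norm_le {v f g : ℝ → ℂ} {s : Set ℝ} (hs : MeasurableSet s)
    (hv : ContinuousOn v τ.I) (hf : τ.InL2 (s.indicator f)) (hg : τ.InL2 (s.indicator g))
    (A B : ℝ) (h : ∀ x ∈ s, ‖v x‖ ≤ A * ‖f x‖ + B * ‖g x‖) : τ.InL2 (s.indicator v) := by
  have hm : AEStronglyMeasurable (s.indicator v) τ.μ :=
    ((hv.aestronglyMeasurable measurableSet_I).mono_ac
      (withDensity_absolutelyContinuous _ _)).indicator hs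
  refine MemLp.mono' ((hf.norm.const_mul A).add (hg.norm.const_mul B)) hm
    (.of_forall fun x => ?_)
  by_cases hx : x ∈ s
  · simpa [hx] using h x hx
  · simp [hx]

/-- In the limit point case at `b`, no fundamental system lies in `L²` near `b`. -/
theorem LimitPointB.not_inL2 (hb : τ.LimitPointB) {z : ℂ} {u v : ℝ → ℂ} (hu : τ.IsSol z u)
    (hv : τ.IsSol z v) (hW : ∀ x ∈ τ.I, τ.W u v x = 1) {e : ℝ} (he : e ∈ τ.I)
    (hu2 : τ.InL2 ((ivl (e : EReal) τ.b).indicator u))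
    (hv2 : τ.InL2 ((ivl (e : EReal) τ.b).indicator v)) : False := by
  obtain ⟨y, hy, hy2⟩ := hb z
  obtain ⟨A, hA⟩ := hy.exists_W_eq hv
  obtain ⟨B, hB⟩ := hy.exists_W_eq hu
  refine hy2 ⟨e, he, InL2.of_norm_le (measurableSet_ivl _ _) hy.1.1.continuousOn hu2 hv2
    ‖A‖ ‖B‖ fun x hx => ?_⟩
  have hx' := ivl_right_subset he hx
  rw [eq_comb_of_W_eq_one y (hW x hx'), hA x hx', hB x hx']
  refine (norm_sub_le _ _).trans ?_
  rw [norm_mul, norm_mul, mul_comm, mul_comm ‖v x‖]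

theorem mem_I_of_ivl_left {c y : ℝ} (hc : c ∈ τ.I) (hy : y ∈ ivl τ.a (c : EReal)) : y ∈ τ.I :=
  ivl_left_subset hc hy

theorem intervalIntegrable_inv_p_sq {u : ℝ → ℝ} (hu : τ.ACLoc (cx u)) {α β : ℝ}
    (hα : α ∈ τ.I) (hβ : β ∈ τ.I) (h0 : ∀ x ∈ uIcc α β, u x ≠ 0) :
    IntervalIntegrable (fun x => (τ.p x)⁻¹ * (u x ^ 2)⁻¹) volume α β := by
  have hc : ContinuousOn u (uIcc α β) :=
    (Complex.continuous_re.comp_continuousOn hu.continuousOn).mono (uIcc_subset_I hα hβ)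
  exact (intervalIntegrable_p_inv hα hβ).mul_continuousOn
    ((hc.pow 2).inv₀ fun x hx => pow_ne_zero 2 (h0 x hx))

/-- `(v/u)' = 1/(p u²)` if `W(u,v) = 1`, in integrated form. -/
theorem integral_inv_p_sq {u v : ℝ → ℝ} (hu : τ.ACLoc (cx u)) (hv : τ.ACLoc (cx v))
    (hW : ∀ x ∈ τ.I, τ.W (cx u) (cx v) x = 1) {α β : ℝ}
    (hα : α ∈ τ.I) (hβ : β ∈ τ.I) (h0 : ∀ x ∈ uIcc α β, u x ≠ 0) :
    ∫ x in α..β, (τ.p x)⁻¹ * (u x ^ 2)⁻¹ = v β / u β - v α / u α := by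
  have h := (ACLoc.div hu hv hα hβ h0).integral_eq_sub_of_ae_deriv_eq
    (f' := fun x => (((τ.p x)⁻¹ * (u x ^ 2)⁻¹ : ℝ) : ℂ)) (by
      filter_upwards [hasDerivAt_div hu hv] with x hx hx'
      have hxI := uIcc_subset_I hα hβ hx'
      rw [(hx hxI (h0 x hx')).deriv, hW x hxI]
      push_cast
      ring)
  rw [intervalIntegral.integral_ofReal] at h
  unfold cx at h
  exact_mod_cast h

theorem ae_inv_p_sq_nonneg (u : ℝ → ℝ) : ∀ᵐ x, x ∈ τ.I → 0 ≤ (τ.p x)⁻¹ * (u x ^ 2)⁻¹ := by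
  filter_upwards [τ.ae_p_pos] with x hx hx'
  have := hx hx'
  positivity

/-- `|(f/u)'|` is `|N_u f|` times `1/(√p |u|)`, and weighted AM-GM bounds the product. The free
weight `t` lets this stand in for Cauchy–Schwarz: `t = 1` suffices for integrability at `a`, and `t`
is optimized in the growth bound at `b`. -/
theorem norm_deriv_div_le (u : ℝ → ℝ) (f : ℝ → ℂ) {t : ℝ} (ht : 0 < t) :
    ∀ᵐ x, x ∈ τ.I → u x ≠ 0 → ‖deriv (fun y => f y / (u y : ℂ)) x‖ ≤
      (t * ‖τ.N u f x‖ ^ 2 + t⁻¹ * ((τ.p x)⁻¹ * (u x ^ 2)⁻¹)) / 2 := by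
  filter_upwards [τ.ae_p_pos] with x hp hxI h0
  have hp' := hp hxI
  have hv0 := abs_pos.2 h0
  have hs := Real.sqrt_pos.2 hp'
  set D := ‖deriv (fun y => f y / (u y : ℂ)) x‖ with hD
  set k := Real.sqrt (τ.p x) * |u x| with hk
  have hk0 : 0 < k := by positivity
  have e1 : ‖τ.N u f x‖ = k * D := by
    unfold N
    rw [norm_mul, norm_mul, Complex.norm_real, Complex.norm_real, Real.norm_eq_abs,
      Real.norm_eq_abs, abs_of_pos hs]
  have e2 : (τ.p x)⁻¹ * (u x ^ 2)⁻¹ = (k⁻¹) ^ 2 := by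
    rw [hk, inv_pow, mul_pow, Real.sq_sqrt hp'.le, sq_abs, mul_inv]
  rw [e1, e2]
  have e3 : (t * (k * D) ^ 2 + t⁻¹ * k⁻¹ ^ 2) / 2 - D = t⁻¹ * (t * (k * D) - k⁻¹) ^ 2 / 2 := by
    field_simp
    ring
  have e4 : 0 ≤ t⁻¹ * (t * (k * D) - k⁻¹) ^ 2 / 2 := by positivity
  linarith

/-- `|N_u g|²` equals `|W(u,g)|²/(p u²)`, a bounded function times an integrable one. -/
theorem memLp_N_of_bounded {u : ℝ → ℝ} {g : ℝ → ℂ} (hu : τ.ACLoc (cx u)) (hg : τ.ACLoc g)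
    {s : Set ℝ} (hs : MeasurableSet s) (hsI : s ⊆ τ.I) (h0 : ∀ x ∈ s, u x ≠ 0)
    (hint : IntegrableOn (fun x => (τ.p x)⁻¹ * (u x ^ 2)⁻¹) s) (C : ℝ)
    (hC : ∀ x ∈ s, ‖τ.W (cx u) g x‖ ≤ C) : MemLp (τ.N u g) 2 (volume.restrict s) := by
  have hm := aestronglyMeasurable_N hu g hsI
  rw [memLp_two_iff_integrable_sq_norm hm]
  refine (hint.mul_const (C ^ 2)).mono' (hm.norm.pow 2) ((ae_restrict_iff' hs).2 ?_)
  filter_upwards [norm_N_sq_ae_eq hu hg, ae_inv_p_sq_nonneg (τ := τ) u] with x h1 h2 hx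
  rw [Real.norm_eq_abs, abs_of_nonneg (sq_nonneg _), h1 (hsI hx) (h0 x hx)]
  exact mul_le_mul_of_nonneg_left (pow_le_pow_left₀ (norm_nonneg _) (hC x hx) 2) (h2 (hsI hx))

theorem exists_bound_of_tendsto_rightOf {F : ℝ → ℂ} {L : ℂ} (hF : ContinuousOn F τ.I)
    (hL : Tendsto F (rightOf τ.a) (𝓝 L)) {c : ℝ} (hc : c ∈ τ.I) :
    ∃ C, ∀ x ∈ ivl τ.a (c : EReal), ‖F x‖ ≤ C := by
  have h1 : ∀ᶠ x in rightOf τ.a, ‖F x‖ < ‖L‖ + 1 :=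
    hL.norm.eventually (gt_mem_nhds (lt_add_one _))
  obtain ⟨e, he, h2⟩ := (eventually_rightOf τ.a_lt_b).1 h1
  obtain ⟨C, hC⟩ := isCompact_uIcc.exists_bound_of_continuousOn
    (hF.mono (uIcc_subset_I he hc))
  refine ⟨max C (‖L‖ + 1), fun x hx => ?_⟩
  rcases lt_or_ge x e with h | h
  · exact (h2 x ⟨hx.1, EReal.coe_lt_coe_iff.2 h⟩).le.trans (le_max_right _ _)
  · exact (hC x (mem_uIcc.2 (Or.inl ⟨h, (EReal.coe_lt_coe_iff.1 hx.2).le⟩))).trans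
      (le_max_left _ _)

theorem uIcc_ne_zero_left {u : ℝ → ℝ} {c y : ℝ} (hc : c ∈ τ.I)
    (h0 : ∀ x ∈ τ.I, x ≤ c → u x ≠ 0) (hy : y ∈ ivl τ.a (c : EReal)) :
    ∀ x ∈ uIcc y c, u x ≠ 0 := by
  intro x hx
  have hyI := mem_I_of_ivl_left hc hy
  refine h0 x (uIcc_subset_I hyI hc hx) ?_
  rw [uIcc_of_le (EReal.coe_lt_coe_iff.1 hy.2).le] at hx
  exact hx.2

theorem eventually_mem_I_rightOf : ∀ᶠ x in rightOf τ.a, x ∈ τ.I :=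
  preimage_mem_comap (Ioo_mem_nhdsGT τ.a_lt_b)

/-- The quotient of the principal by a nonprincipal solution stays bounded near `a`. -/
theorem IsPrincipalA.eventually_div_le {lam : ℝ} {u v : ℝ → ℝ} (hu : τ.IsPrincipalA lam u)
    (hv : τ.IsSol lam (cx v)) (hW : ∀ x ∈ τ.I, τ.W (cx v) (cx u) x = 1) :
    ∃ M, ∀ᶠ x in rightOf τ.a, |u x / v x| ≤ M := by
  obtain ⟨hus, w, hw, hW', ho, -⟩ := hu
  obtain ⟨κ, hκ⟩ := hv.exists_W_eq hw
  refine ⟨1, ?_⟩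
  -- Here `w = κ u - v` with `κ = W(v,w)`. With this `ε`, `(|κ| + 1)|u| ≤ |w| ≤ |κ||u| + |v|`, which
  -- leaves `|u| ≤ |v|`.
  have hε : (0 : ℝ) < (‖κ‖ + 1)⁻¹ := by positivity
  filter_upwards [ho.bound hε, eventually_mem_I_rightOf] with x h1 hx
  have h2 : ‖u x‖ * (‖κ‖ + 1) ≤ ‖w x‖ := by
    rwa [inv_mul_eq_div, le_div_iff₀ (by positivity)] at h1
  have h3 : (w x : ℂ) = u x * κ - v x := by
    have h4 := eq_comb_of_W_eq_one (cx v) (hW' x hx)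
    rw [hκ x hx, hW x hx] at h4
    unfold cx at h4
    rw [h4]; ring
  have h4 : ‖w x‖ ≤ ‖u x‖ * ‖κ‖ + ‖v x‖ := by
    rw [← Complex.norm_real (w x), h3]
    refine (norm_sub_le _ _).trans ?_
    rw [norm_mul, Complex.norm_real, Complex.norm_real]
  rw [abs_div]
  refine div_le_one_of_le₀ ?_ (abs_nonneg _)
  simp only [Real.norm_eq_abs] at h2 h4 ⊢
  linarith

/-! ### The limit circle endpoint `a` -/

section LeftEndpoint

variable {lam : ℝ} {u v : ℝ → ℝ} {f g : ℝ → ℂ} {c : ℝ}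

/-- The integral from `y` to `c` is the increment of `u/v`, which stays bounded as `y` approaches
`a`; nonnegativity turns this into integrability. -/
theorem IsPrincipalA.integrableOn_inv_p_sq (hu : τ.IsPrincipalA lam u)
    (hv : τ.IsSol lam (cx v)) (hW : ∀ x ∈ τ.I, τ.W (cx v) (cx u) x = 1) (hc : c ∈ τ.I)
    (h0 : ∀ x ∈ τ.I, x ≤ c → v x ≠ 0) :
    IntegrableOn (fun x => (τ.p x)⁻¹ * (v x ^ 2)⁻¹) (ivl τ.a (c : EReal)) := by
  obtain ⟨M, hM⟩ := hu.eventually_div_le hv hW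
  refine integrableOn_left_of_bounded hc.1 (u c / v c + M) (fun y hy =>
    intervalIntegrable_inv_p_sq hv.1.1 (mem_I_of_ivl_left hc hy) hc (uIcc_ne_zero_left hc h0 hy)) ?_
  filter_upwards [hM, eventually_mem_rightOf hc.1] with y h1 hy
  have hyI := mem_I_of_ivl_left hc hy
  have h2 : ∫ x in y..c, ‖(τ.p x)⁻¹ * (v x ^ 2)⁻¹‖ = ∫ x in y..c, (τ.p x)⁻¹ * (v x ^ 2)⁻¹ := by
    refine intervalIntegral.integral_congr_ae ?_
    filter_upwards [ae_inv_p_sq_nonneg (τ := τ) v] with x hx hx'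
    exact Real.norm_of_nonneg (hx (uIcc_subset_I hyI hc (uIoc_subset_uIcc hx')))
  rw [h2, integral_inv_p_sq hv.1.1 hu.1.1.1 hW hyI hc (uIcc_ne_zero_left hc h0 hy)]
  linarith [neg_abs_le (u y / v y)]

/-- The conjugate on the real function `v` is harmless; it gives the integrand the form of an L²
pairing. -/
theorem W_sub_W_eq_integral (hv : τ.IsSol lam (cx v)) (hg : τ.InD g) {α β : ℝ}
    (hα : α ∈ τ.I) (hβ : β ∈ τ.I) :
    τ.W (cx v) g α - τ.W (cx v) g β =
      ∫ x in α..β, (τ.r x : ℂ) * (conj (cx v x) * (τ.apply g x - lam * g x)) := by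
  have h3 := (hv.1.acLoc_W hg α hα β hβ).integral_eq_sub_of_ae_deriv_eq
    (f' := fun x => -((τ.r x : ℂ) * (conj (cx v x) * (τ.apply g x - lam * g x)))) (by
      filter_upwards [hv.hasDerivAt_W hg] with x hx hx'
      rw [(hx (uIcc_subset_I hα hβ hx')).deriv]
      simp only [cx, Complex.conj_ofReal])
  rw [intervalIntegral.integral_neg] at h3
  linear_combination h3

/-- Near `a` both `v` and `τ g - λ g` are in L², so the derivative of `W(v,g)` is integrable up to
`a`. -/
theorem LimitCircleA.exists_tendsto_W (hlc : τ.LimitCircleA) (hv : τ.IsSol lam (cx v))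
    (hg : τ.DomTmax g) : ∃ L, Tendsto (τ.W (cx v) g) (rightOf τ.a) (𝓝 L) := by
  obtain ⟨e, he, h2⟩ := hlc lam (cx v) hv
  have hint := h2.integrableOn_of_indicator (measurableSet_ivl _ _) (ivl_left_subset he)
    (hg.inL2_sub lam)
  have ht := tendsto_integral_rightOf he.1 hint
  refine ⟨_, ((tendsto_const_nhds (x := τ.W (cx v) g e)).add ht).congr' ?_⟩
  filter_upwards [eventually_mem_rightOf he.1] with y hy
  rw [← W_sub_W_eq_integral hv hg.2.1 (mem_I_of_ivl_left he hy) he]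
  ring

theorem integrableOn_conj_N_mul_N {s : Set ℝ} (hf : MemLp (τ.N v f) 2 (volume.restrict s))
    (hg : MemLp (τ.N v g) 2 (volume.restrict s)) :
    IntegrableOn (fun x => conj (τ.N v f x) * τ.N v g x) s :=
  MemLp.integrable_mul (p := 2) (q := 2) hf.star hg

/-- `(f/v)'` is dominated by `|N_v f|² + 1/(p v²)`, hence integrable up to `a`. -/
theorem exists_tendsto_div_rightOf (hv : τ.ACLoc (cx v)) (hf : τ.ACLoc f) (hc : c ∈ τ.I)
    (h0 : ∀ x ∈ τ.I, x ≤ c → v x ≠ 0)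
    (hint : IntegrableOn (fun x => (τ.p x)⁻¹ * (v x ^ 2)⁻¹) (ivl τ.a (c : EReal)))
    (hN : MemLp (τ.N v f) 2 (volume.restrict (ivl τ.a (c : EReal)))) :
    ∃ L, Tendsto (fun x => f x / (v x : ℂ)) (rightOf τ.a) (𝓝 L) := by
  have hN2 := (memLp_two_iff_integrable_sq_norm hN.1).1 hN
  have hd : IntegrableOn (deriv fun y => f y / (v y : ℂ)) (ivl τ.a (c : EReal)) := by
    refine (hN2.add hint).mono' (measurable_deriv _).aestronglyMeasurable
      ((ae_restrict_iff' (measurableSet_ivl _ _)).2 ?_)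
    filter_upwards [norm_deriv_div_le v f one_pos, ae_inv_p_sq_nonneg (τ := τ) v] with x h1 h2 hx
    have hxI := ivl_left_subset hc hx
    have h3 := h1 hxI (h0 x hxI (EReal.coe_lt_coe_iff.1 hx.2).le)
    have h4 := h2 hxI
    simp only [one_mul, inv_one] at h3
    change _ ≤ ‖τ.N v f x‖ ^ 2 + (τ.p x)⁻¹ * (v x ^ 2)⁻¹
    nlinarith [sq_nonneg ‖τ.N v f x‖]
  refine ⟨_, ((tendsto_const_nhds (x := f c / (v c : ℂ))).sub
    (tendsto_integral_rightOf hc.1 hd)).congr' ?_⟩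
  filter_upwards [eventually_mem_rightOf hc.1] with y hy
  rw [(ACLoc.div hv hf (mem_I_of_ivl_left hc hy) hc
    (uIcc_ne_zero_left hc h0 hy)).complex_integral_deriv_eq_sub]
  ring

/-- Green's formula up to the endpoint `a`. -/
theorem integral_conj_N_mul_N_left (hv : τ.IsSol lam (cx v)) (hf : τ.ACLoc f)
    (hf2 : τ.InL2 f) (hg : τ.DomTmax g) (hc : c ∈ τ.I) (h0 : ∀ x ∈ τ.I, x ≤ c → v x ≠ 0)
    (hNf : MemLp (τ.N v f) 2 (volume.restrict (ivl τ.a (c : EReal))))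
    (hNg : MemLp (τ.N v g) 2 (volume.restrict (ivl τ.a (c : EReal)))) {A B : ℂ}
    (hA : Tendsto (fun x => f x / (v x : ℂ)) (rightOf τ.a) (𝓝 A))
    (hB : Tendsto (τ.W (cx v) g) (rightOf τ.a) (𝓝 B)) :
    ∫ x in ivl τ.a (c : EReal), conj (τ.N v f x) * τ.N v g x =
      conj (f c / (v c : ℂ)) * τ.W (cx v) g c - conj A * B
      + ∫ x in ivl τ.a (c : EReal),
          (τ.r x : ℂ) * (conj (f x) * (τ.apply g x - lam * g x)) := by
  have := neBot_rightOf hc.1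
  have h1 := tendsto_integral_rightOf hc.1 (integrableOn_conj_N_mul_N hNf hNg)
  have h2 := tendsto_integral_rightOf hc.1
    ((hf2.integrableOn (hg.inL2_sub lam)).mono_set (ivl_left_subset hc))
  have h3 := (((Complex.continuous_conj.tendsto A).comp hA).mul hB).const_sub
    (conj (f c / (v c : ℂ)) * τ.W (cx v) g c)
  refine tendsto_nhds_unique h1 ((h3.add h2).congr' ?_)
  filter_upwards [eventually_mem_rightOf hc.1] with y hy
  exact (integral_conj_N_mul_N hv hf hg.2.1 (mem_I_of_ivl_left hc hy) hc
    (uIcc_ne_zero_left hc h0 hy)).symm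

end LeftEndpoint

/-! ### The endpoint `b`: monotonicity and domination estimates -/

section RightEndpoint

variable {lam : ℝ} {u v : ℝ → ℝ} {f g : ℝ → ℂ} {d : ℝ}

theorem mem_I_of_ivl_right {d y : ℝ} (hd : d ∈ τ.I) (hy : y ∈ ivl (d : EReal) τ.b) : y ∈ τ.I :=
  ivl_right_subset hd hy

theorem mem_ivl_right {d y : ℝ} (hy : y ∈ τ.I) (hdy : d < y) : y ∈ ivl (d : EReal) τ.b :=
  ⟨EReal.coe_lt_coe_iff.2 hdy, hy.2⟩

theorem uIcc_ne_zero_right {α β : ℝ} (hα : α ∈ τ.I) (hβ : β ∈ τ.I)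
    (h0 : ∀ x ∈ τ.I, d ≤ x → u x ≠ 0) (hdα : d ≤ α) (hdβ : d ≤ β) :
    ∀ x ∈ uIcc α β, u x ≠ 0 := fun x hx =>
  h0 x (uIcc_subset_I hα hβ hx) ((le_min hdα hdβ).trans hx.1)

theorem conj_N_mul_N_self (x : ℝ) :
    conj (τ.N u g x) * τ.N u g x = ((‖τ.N u g x‖ ^ 2 : ℝ) : ℂ) := by
  rw [← Complex.normSq_eq_conj_mul_self, Complex.normSq_eq_norm_sq]

theorem intervalIntegrable_norm_N_sq (hu : τ.InD (cx u)) (hg : τ.InD g) {α β : ℝ}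
    (hα : α ∈ τ.I) (hβ : β ∈ τ.I) (h0 : ∀ x ∈ uIcc α β, u x ≠ 0) :
    IntervalIntegrable (fun x => ‖τ.N u g x‖ ^ 2) volume α β := by
  refine (intervalIntegrable_conj_N_mul_N hu hg.1 hg hα hβ h0).norm.congr
    (fun x _ => ?_)
  rw [norm_mul, RCLike.norm_conj, sq]

/-- The energy of `g` up to `y` agrees with `Re (conj (g/u) W(u,g))(y)` up to a constant. -/
theorem exists_energy_bound (hu : τ.IsSol lam (cx u)) (hg : τ.DomTmax g) (hd : d ∈ τ.I)
    (h0 : ∀ x ∈ τ.I, d ≤ x → u x ≠ 0) :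
    ∃ C, ∀ y ∈ τ.I, d ≤ y → |(∫ x in d..y, ‖τ.N u g x‖ ^ 2)
      - (conj (g y / (u y : ℂ)) * τ.W (cx u) g y).re| ≤ C := by
  have hint := (hg.1.integrableOn (hg.inL2_sub lam)).mono_set (ivl_right_subset hd)
  refine ⟨‖conj (g d / (u d : ℂ)) * τ.W (cx u) g d‖ + ∫ x in ivl (d : EReal) τ.b,
    ‖(τ.r x : ℂ) * (conj (g x) * (τ.apply g x - lam * g x))‖, fun y hy hdy => ?_⟩
  have h1 := integral_conj_N_mul_N hu hg.2.1.1 hg.2.1 hd hy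
    (uIcc_ne_zero_right hd hy h0 le_rfl hdy)
  simp only [conj_N_mul_N_self] at h1
  rw [intervalIntegral.integral_ofReal] at h1
  have h2 := congrArg Complex.re h1
  rw [Complex.ofReal_re, Complex.add_re, Complex.sub_re] at h2
  rw [h2]
  have h3 := Complex.abs_re_le_norm (conj (g d / (u d : ℂ)) * τ.W (cx u) g d)
  have h4 := (Complex.abs_re_le_norm _).trans ((intervalIntegral.norm_integral_le_integral_norm hdy
    (f := fun x => (τ.r x : ℂ) * (conj (g x) * (τ.apply g x - lam * g x))) (μ := volume)).trans
    (intervalIntegral_le_of_integrableOn_right (fun x => norm_nonneg _) hint.norm le_rfl hdy hy.2))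
  rw [abs_le] at h3 h4 ⊢
  constructor <;> linarith [h3.1, h3.2, h4.1, h4.2]

theorem intervalIntegrable_inv_p_sq_mul_W (hu : τ.InD (cx u)) (hg : τ.InD g) {α β : ℝ}
    (hα : α ∈ τ.I) (hβ : β ∈ τ.I) (h0 : ∀ x ∈ uIcc α β, u x ≠ 0) :
    IntervalIntegrable (fun x => (((τ.p x)⁻¹ * (u x ^ 2)⁻¹ : ℝ) : ℂ) * τ.W (cx u) g x)
      volume α β := by
  have h := intervalIntegrable_inv_p_sq hu.1 hα hβ h0
  have h' : IntervalIntegrable (fun x => (((τ.p x)⁻¹ * (u x ^ 2)⁻¹ : ℝ) : ℂ)) volume α β :=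
    ⟨h.1.ofReal, h.2.ofReal⟩
  exact h'.mul_continuousOn ((hu.acLoc_W hg).continuousOn.mono (uIcc_subset_I hα hβ))

theorem integral_inv_p_sq_mul_W (hu : τ.InD (cx u)) (hg : τ.InD g) {α β : ℝ}
    (hα : α ∈ τ.I) (hβ : β ∈ τ.I) (h0 : ∀ x ∈ uIcc α β, u x ≠ 0) :
    ∫ x in α..β, (((τ.p x)⁻¹ * (u x ^ 2)⁻¹ : ℝ) : ℂ) * τ.W (cx u) g x =
      g β / (u β : ℂ) - g α / (u α : ℂ) := by
  refine (ACLoc.div hu.1 hg.1 hα hβ h0).integral_eq_sub_of_ae_deriv_eq ?_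
  filter_upwards [hasDerivAt_div hu.1 hg.1] with x hx hx'
  rw [(hx (uIcc_subset_I hα hβ hx') (h0 x hx')).deriv]
  push_cast
  ring

/-- The derivative of `|g/u|²` is `2/(p u²)` times the real part assumed nonnegative. -/
theorem norm_div_le_of_re_nonneg (hu : τ.InD (cx u)) (hg : τ.InD g) {α β : ℝ}
    (hα : α ∈ τ.I) (hβ : β ∈ τ.I) (hαβ : α ≤ β) (h0 : ∀ x ∈ uIcc α β, u x ≠ 0)
    (hre : ∀ x ∈ uIcc α β, 0 ≤ (conj (g x / (u x : ℂ)) * τ.W (cx u) g x).re) :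
    ‖g α / (u α : ℂ)‖ ≤ ‖g β / (u β : ℂ)‖ := by
  have hac := ACLoc.div hu.1 hg.1 hα hβ h0
  have h := (hac.complex_conj.complex_mul hac).integral_eq_sub_of_ae_deriv_eq
    (f' := fun x => ((2 * ((τ.p x)⁻¹ * (u x ^ 2)⁻¹) *
      (conj (g x / (u x : ℂ)) * τ.W (cx u) g x).re : ℝ) : ℂ)) (by
      filter_upwards [hasDerivAt_div hu.1 hg.1] with x hx hx'
      have h1 := hx (uIcc_subset_I hα hβ hx') (h0 x hx')
      refine ((h1.star.mul h1).deriv).trans ?_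
      rw [Complex.ofReal_mul, Complex.re_eq_add_conj]
      simp only [map_mul, Complex.conj_ofReal, RCLike.star_def, map_inv₀, map_pow,
        Complex.conj_conj]
      push_cast
      ring)
  rw [intervalIntegral.integral_ofReal, ← Complex.normSq_eq_conj_mul_self,
    ← Complex.normSq_eq_conj_mul_self, ← Complex.ofReal_sub, Complex.ofReal_inj,
    Complex.normSq_eq_norm_sq, Complex.normSq_eq_norm_sq] at h
  have h2 : 0 ≤ ∫ x in α..β, 2 * ((τ.p x)⁻¹ * (u x ^ 2)⁻¹) *
      (conj (g x / (u x : ℂ)) * τ.W (cx u) g x).re := by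
    refine intervalIntegral.integral_nonneg_of_ae_restrict hαβ
      ((ae_restrict_iff' measurableSet_Icc).2 ?_)
    filter_upwards [ae_inv_p_sq_nonneg (τ := τ) u] with x hx hx'
    rw [← uIcc_of_le hαβ] at hx'
    exact mul_nonneg (mul_nonneg zero_le_two (hx (uIcc_subset_I hα hβ hx'))) (hre x hx')
  rw [h] at h2
  exact (pow_le_pow_iff_left₀ (norm_nonneg _) (norm_nonneg _) two_ne_zero).1 (by linarith)

/-- If `|g/u|` is nondecreasing on `[y₀, b)` and `W(u,g)` vanishes at `b`, then `(g/u) W(u,g)` is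
bounded near `b`. -/
theorem norm_div_mul_W_le (hu : τ.IsSol lam (cx u)) (hg : τ.DomTmax g) {y₀ : ℝ} (hy₀ : y₀ ∈ τ.I)
    (h0 : ∀ x ∈ τ.I, y₀ ≤ x → u x ≠ 0)
    (hu2 : τ.InL2 ((ivl (y₀ : EReal) τ.b).indicator (cx u)))
    (hmono : ∀ x ∈ τ.I, ∀ t ∈ τ.I, y₀ ≤ x → x ≤ t → ‖g x / (u x : ℂ)‖ ≤ ‖g t / (u t : ℂ)‖)
    (hW : Tendsto (τ.W (cx u) g) (leftOf τ.b) (𝓝 0)) :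
    ∀ x ∈ τ.I, y₀ ≤ x → ‖g x / (u x : ℂ)‖ * ‖τ.W (cx u) g x‖ ≤
      ∫ t in ivl (y₀ : EReal) τ.b, ‖(τ.r t : ℂ) * (conj (g t) * (τ.apply g t - lam * g t))‖ := by
  intro x hx hyx
  have := neBot_leftOf τ.a_lt_b
  have hint := ((hg.1.integrableOn (hg.inL2_sub lam)).mono_set (ivl_right_subset hy₀)).norm
  have hint' := (hu2.integrableOn_of_indicator (measurableSet_ivl _ _) (ivl_right_subset hy₀)
    (hg.inL2_sub lam)).norm
  have ht : Tendsto (fun y => ‖g x / (u x : ℂ)‖ * ‖τ.W (cx u) g x - τ.W (cx u) g y‖) (leftOf τ.b)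
      (𝓝 (‖g x / (u x : ℂ)‖ * ‖τ.W (cx u) g x - 0‖)) :=
    (hW.const_sub _).norm.const_mul _
  rw [sub_zero] at ht
  refine le_of_tendsto ht ?_
  filter_upwards [eventually_mem_leftOf hx.2] with y hy
  have hyI := mem_I_of_ivl_right hx hy
  have hxy : x ≤ y := (EReal.coe_lt_coe_iff.1 hy.1).le
  have hsub : Ioc x y ⊆ ivl (y₀ : EReal) τ.b := fun t ht =>
    ⟨EReal.coe_lt_coe_iff.2 (hyx.trans_lt ht.1), (EReal.coe_le_coe_iff.2 ht.2).trans_lt hy.2⟩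
  rw [W_sub_W_eq_integral hu hg.2.1 hx hyI]
  refine le_trans (mul_le_mul_of_nonneg_left
    (intervalIntegral.norm_integral_le_integral_norm hxy) (norm_nonneg _)) ?_
  refine le_trans ?_ (intervalIntegral_le_of_integrableOn_right (fun x => norm_nonneg _) hint hyx
    hxy hy.2)
  rw [← intervalIntegral.integral_const_mul]
  refine intervalIntegral.integral_mono_on hxy ?_ ?_ fun t ht => ?_
  · exact ((intervalIntegrable_iff_integrableOn_Ioc_of_le hxy).2 (IntegrableOn.mono_set hint' hsub)).const_mul _
  · exact (intervalIntegrable_iff_integrableOn_Ioc_of_le hxy).2 (IntegrableOn.mono_set hint hsub)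
  · have htI : t ∈ τ.I := uIcc_subset_I hx hyI (by rwa [uIcc_of_le hxy])
    have hut : (u t : ℂ) ≠ 0 := by exact_mod_cast h0 t htI (hyx.trans ht.1)
    -- Monotonicity moves the factor `|g/u|` from `x` to `t` under the integral, where it cancels
    -- `u` and leaves the integrable `r |g| |τ g - λ g|`.
    have h1 : ‖g x / (u x : ℂ)‖ * ‖cx u t‖ ≤ ‖g t‖ := by
      calc _ ≤ ‖g t / (u t : ℂ)‖ * ‖cx u t‖ :=
            mul_le_mul_of_nonneg_right (hmono x hx t htI hyx ht.1) (norm_nonneg _)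
        _ = ‖g t‖ := by
            rw [← norm_mul]; unfold cx; rw [div_mul_cancel₀ _ hut]
    simp only [norm_mul, RCLike.norm_conj]
    calc _ = ‖(τ.r t : ℂ)‖ * (‖g x / (u x : ℂ)‖ * ‖cx u t‖ * ‖τ.apply g t - lam * g t‖) := by ring
      _ ≤ _ := by gcongr

/-- If `W(u,g)` has a nonzero limit at `b`, then a second solution is dominated by `u` and `g`. -/
theorem inL2_of_tendsto_W_ne_zero (hu : τ.InD (cx u)) (hv : τ.ACLoc (cx v))
    (hW : ∀ x ∈ τ.I, τ.W (cx u) (cx v) x = 1) (hg : τ.InD g) (hg2 : τ.InL2 g) {y₀ : ℝ}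
    (hy₀ : y₀ ∈ τ.I) (h0 : ∀ x ∈ τ.I, y₀ ≤ x → u x ≠ 0)
    (hu2 : τ.InL2 ((ivl (y₀ : EReal) τ.b).indicator (cx u))) {L : ℂ} (hL : L ≠ 0)
    (hWL : Tendsto (τ.W (cx u) g) (leftOf τ.b) (𝓝 L)) :
    ∃ e ∈ τ.I, y₀ ≤ e ∧ τ.InL2 ((ivl (e : EReal) τ.b).indicator (cx v)) := by
  have hL0 : 0 < ‖L‖ := norm_pos_iff.2 hL
  have h1 : ∀ᶠ x in leftOf τ.b, ‖τ.W (cx u) g x - L‖ < ‖L‖ / 2 := by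
    have := (hWL.sub_const L).norm
    rw [sub_self, norm_zero] at this
    exact this.eventually (gt_mem_nhds (by positivity))
  obtain ⟨e₀, he₀, h2⟩ := (eventually_leftOf τ.a_lt_b).1 h1
  obtain ⟨e, he, hye, hee⟩ : ∃ e ∈ τ.I, y₀ ≤ e ∧ e₀ ≤ e := by
    rcases le_total y₀ e₀ with h | h
    · exact ⟨e₀, he₀, h, le_rfl⟩
    · exact ⟨y₀, hy₀, le_rfl, h⟩
  refine ⟨e, he, hye, InL2.of_norm_le (f := cx u) (g := g) (measurableSet_ivl _ _) hv.continuousOn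
    (hu2.indicator_mono (measurableSet_ivl _ _) (ivl_mono (EReal.coe_le_coe_iff.2 hye) le_rfl))
    (hg2.indicator (measurableSet_ivl _ _))
    (|v e / u e| + 2 / ‖L‖ * ‖g e / (u e : ℂ)‖) (2 / ‖L‖) fun x hx => ?_⟩
  have hxI := mem_I_of_ivl_right he hx
  have hex : e ≤ x := (EReal.coe_lt_coe_iff.1 hx.1).le
  have hne := uIcc_ne_zero_right he hxI h0 hye (hye.trans hex)
  -- `s` is the integral of `1/(p u²)` over `[e,x]`. As `W(u,g)` stays within `|L|/2` of `L`, the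
  -- increment of `g/u` is within `s |L|/2` of `s L`, so `s` is controlled by `|g/u|`, and `v = u (s
  -- + const)` by `|g|` and `|u|`.
  set s := v x / u x - v e / u e with hs
  have hint := intervalIntegrable_inv_p_sq hu.1 he hxI hne
  have e1 := integral_inv_p_sq hu.1 hv hW he hxI hne
  have e2 := integral_inv_p_sq_mul_W hu hg he hxI hne
  have hs0 : 0 ≤ s := by
    rw [hs, ← e1]
    refine intervalIntegral.integral_nonneg_of_ae_restrict hex
      ((ae_restrict_iff' measurableSet_Icc).2 ?_)
    filter_upwards [ae_inv_p_sq_nonneg (τ := τ) u] with t ht ht'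
    rw [← uIcc_of_le hex] at ht'
    exact ht (uIcc_subset_I he hxI ht')
  have e3 : g x / (u x : ℂ) - g e / (u e : ℂ) - s * L =
      ∫ t in e..x, (((τ.p t)⁻¹ * (u t ^ 2)⁻¹ : ℝ) : ℂ) * (τ.W (cx u) g t - L) := by
    have hi' : IntervalIntegrable (fun x => (((τ.p x)⁻¹ * (u x ^ 2)⁻¹ : ℝ) : ℂ)) volume e x :=
      ⟨hint.1.ofReal, hint.2.ofReal⟩
    simp only [mul_sub]
    rw [intervalIntegral.integral_sub (intervalIntegrable_inv_p_sq_mul_W hu hg he hxI hne)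
      (hi'.mul_const L), e2, intervalIntegral.integral_mul_const,
      intervalIntegral.integral_ofReal, e1]
  have e4 : ‖g x / (u x : ℂ) - g e / (u e : ℂ) - s * L‖ ≤ s * (‖L‖ / 2) := by
    rw [e3, hs, ← e1, ← intervalIntegral.integral_mul_const]
    refine intervalIntegral.norm_integral_le_of_norm_le hex ?_ (hint.mul_const _)
    filter_upwards [ae_inv_p_sq_nonneg (τ := τ) u] with t ht ht'
    have htI : t ∈ τ.I := uIcc_subset_I he hxI (uIoc_subset_uIcc (by rwa [uIoc_of_le hex]))
    rw [norm_mul, Complex.norm_real, Real.norm_of_nonneg (ht htI)]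
    exact mul_le_mul_of_nonneg_left (h2 t (mem_ivl_right htI (hee.trans_lt ht'.1))).le (ht htI)
  have e5 : s * ‖L‖ ≤ s * (‖L‖ / 2) + ‖g x / (u x : ℂ)‖ + ‖g e / (u e : ℂ)‖ := by
    have : (s : ℂ) * L = (g x / (u x : ℂ) - g e / (u e : ℂ)) -
      (g x / (u x : ℂ) - g e / (u e : ℂ) - s * L) := by ring
    have h5 : ‖(s : ℂ) * L‖ = s * ‖L‖ := by
      rw [norm_mul, Complex.norm_real, Real.norm_of_nonneg hs0]
    rw [← h5, this]
    refine (norm_sub_le _ _).trans ?_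
    linarith [norm_sub_le (g x / (u x : ℂ)) (g e / (u e : ℂ))]
  have e6 : s ≤ 2 / ‖L‖ * (‖g x / (u x : ℂ)‖ + ‖g e / (u e : ℂ)‖) := by
    rw [div_mul_eq_mul_div, le_div_iff₀ hL0]
    linarith
  have hux : u x ≠ 0 := hne x right_mem_uIcc
  have hux' : (u x : ℂ) ≠ 0 := by exact_mod_cast hux
  have e7 : v x = u x * (s + v e / u e) := by rw [hs]; field_simp; ring
  have e8 : ‖g x‖ = |u x| * ‖g x / (u x : ℂ)‖ := by
    rw [norm_div, Complex.norm_real, Real.norm_eq_abs]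
    have := abs_ne_zero.2 hux
    field_simp
  unfold cx
  rw [Complex.norm_real, Complex.norm_real, Real.norm_eq_abs, Real.norm_eq_abs, e7, abs_mul, e8]
  calc _ ≤ |u x| * (s + |v e / u e|) := by
        gcongr
        exact (abs_add_le _ _).trans (by rw [abs_of_nonneg hs0])
    _ ≤ |u x| * (2 / ‖L‖ * (‖g x / (u x : ℂ)‖ + ‖g e / (u e : ℂ)‖) + |v e / u e|) := by gcongr
    _ = _ := by ring

end RightEndpoint

/-! ### Finite energy and the vanishing boundary term at `b` -/

section RightEndpoint

variable {lam : ℝ} {u v : ℝ → ℝ} {f g : ℝ → ℂ} {d : ℝ}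

theorem tendsto_W_leftOf (hu : τ.IsSol lam (cx u)) (hg : τ.DomTmax g) {e : ℝ} (he : e ∈ τ.I)
    (hu2 : τ.InL2 ((ivl (e : EReal) τ.b).indicator (cx u))) :
    ∃ L, Tendsto (τ.W (cx u) g) (leftOf τ.b) (𝓝 L) := by
  have hint := hu2.integrableOn_of_indicator (measurableSet_ivl _ _) (ivl_right_subset he)
    (hg.inL2_sub lam)
  refine ⟨_, ((tendsto_integral_leftOf he.2 hint).const_sub (τ.W (cx u) g e)).congr' ?_⟩
  filter_upwards [eventually_mem_leftOf he.2] with y hy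
  rw [← W_sub_W_eq_integral hu hg.2.1 he (mem_I_of_ivl_right he hy)]
  ring

/-- In the limit point case at `b`, elements of the maximal domain have finite energy. -/
theorem LimitPointB.exists_energy_le (hb : τ.LimitPointB) (hu : τ.IsSol lam (cx u))
    (hv : τ.IsSol lam (cx v)) (hW : ∀ x ∈ τ.I, τ.W (cx u) (cx v) x = 1) (hg : τ.DomTmax g)
    (hd : d ∈ τ.I) (h0 : ∀ x ∈ τ.I, d ≤ x → u x ≠ 0) :
    ∃ M, ∀ y ∈ τ.I, d ≤ y → ∫ x in d..y, ‖τ.N u g x‖ ^ 2 ≤ M := by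
  by_contra! hunb
  obtain ⟨C, hC⟩ := exists_energy_bound hu hg hd h0
  -- Energy above `C + 1` at `y₀` persists to the right, since energy is nondecreasing. This forces
  -- the real part of the boundary term to be at least one there.
  obtain ⟨y₀, hy₀, hdy₀, hE₀⟩ := hunb (C + 1)
  have hEmono : ∀ y ∈ τ.I, y₀ ≤ y →
      ∫ x in d..y₀, ‖τ.N u g x‖ ^ 2 ≤ ∫ x in d..y, ‖τ.N u g x‖ ^ 2 := fun y hy hyy =>
    intervalIntegral.integral_mono_interval le_rfl hdy₀ hyy (.of_forall fun x => sq_nonneg _)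
      (intervalIntegrable_norm_N_sq hu.1 hg.2.1 hd hy
        (uIcc_ne_zero_right hd hy h0 le_rfl (hdy₀.trans hyy)))
  have hre : ∀ y ∈ τ.I, y₀ ≤ y → 1 ≤ (conj (g y / (u y : ℂ)) * τ.W (cx u) g y).re := by
    intro y hy hyy
    have h1 := (abs_le.1 (hC y hy (hdy₀.trans hyy))).2
    linarith [hEmono y hy hyy]
  have h0' : ∀ x ∈ τ.I, y₀ ≤ x → u x ≠ 0 := fun x hx hyx => h0 x hx (hdy₀.trans hyx)
  have hmono : ∀ x ∈ τ.I, ∀ t ∈ τ.I, y₀ ≤ x → x ≤ t →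
      ‖g x / (u x : ℂ)‖ ≤ ‖g t / (u t : ℂ)‖ := fun x hx t ht hyx hxt =>
    norm_div_le_of_re_nonneg hu.1 hg.2.1 hx ht hxt
      (uIcc_ne_zero_right hx ht h0' hyx (hyx.trans hxt)) fun s hs =>
        zero_le_one.trans (hre s (uIcc_subset_I hx ht hs)
          (hyx.trans (by rw [uIcc_of_le hxt] at hs; exact hs.1)))
  have hφ : 0 < ‖g y₀ / (u y₀ : ℂ)‖ := by
    rw [norm_pos_iff]
    intro h
    have := hre y₀ hy₀ le_rfl
    rw [h, map_zero, zero_mul, Complex.zero_re] at this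
    linarith
  have hg2 : τ.InL2 ((ivl (y₀ : EReal) τ.b).indicator g) := hg.1.indicator (measurableSet_ivl _ _)
  have hu2 : τ.InL2 ((ivl (y₀ : EReal) τ.b).indicator (cx u)) := by
    refine InL2.of_norm_le (measurableSet_ivl _ _) hu.1.1.continuousOn hg2 hg2
      ‖g y₀ / (u y₀ : ℂ)‖⁻¹ 0 fun x hx => ?_
    have hxI := mem_I_of_ivl_right hy₀ hx
    have hyx := (EReal.coe_lt_coe_iff.1 hx.1).le
    have h1 := hmono y₀ hy₀ x hxI le_rfl hyx
    have h2 : 0 < ‖(u x : ℂ)‖ := norm_pos_iff.2 (by exact_mod_cast h0' x hxI hyx)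
    rw [zero_mul, add_zero, inv_mul_eq_div, le_div_iff₀ hφ]
    rw [norm_div (g x), le_div_iff₀ h2, mul_comm] at h1
    exact h1
  obtain ⟨L, hL⟩ := tendsto_W_leftOf hu hg hy₀ hu2
  rcases eq_or_ne L 0 with rfl | hL0
  · have hbd := norm_div_mul_W_le hu hg hy₀ h0' hu2 hmono hL
    set K := ∫ t in ivl (y₀ : EReal) τ.b,
      ‖(τ.r t : ℂ) * (conj (g t) * (τ.apply g t - lam * g t))‖
    -- The first entry of the maximum excludes `y ≤ y₀`; the second contradicts the bound `K` on the
    -- boundary term when `y₀ ≤ y`.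
    obtain ⟨y, hy, hdy, hEy⟩ := hunb (max (∫ x in d..y₀, ‖τ.N u g x‖ ^ 2) (C + K))
    rcases le_total y₀ y with h | h
    · have h1 := (abs_le.1 (hC y hy hdy)).2
      have h2 := (le_abs_self _).trans
        (Complex.abs_re_le_norm (conj (g y / (u y : ℂ)) * τ.W (cx u) g y))
      rw [norm_mul, RCLike.norm_conj] at h2
      linarith [hbd y hy h, (le_max_right _ _).trans_lt hEy]
    · have h1 : ∫ x in d..y, ‖τ.N u g x‖ ^ 2 ≤ ∫ x in d..y₀, ‖τ.N u g x‖ ^ 2 :=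
        intervalIntegral.integral_mono_interval le_rfl hdy h (.of_forall fun x => sq_nonneg _)
          (intervalIntegrable_norm_N_sq hu.1 hg.2.1 hd hy₀
            (uIcc_ne_zero_right hd hy₀ h0 le_rfl hdy₀))
      linarith [(le_max_left _ _).trans_lt hEy]
  · obtain ⟨e, he, hye, hv2⟩ := inL2_of_tendsto_W_ne_zero hu.1 hv.1.1 hW hg.2.1 hg.1 hy₀ h0' hu2
      hL0 hL
    exact hb.not_inL2 hu hv hW he (hu2.indicator_mono (measurableSet_ivl _ _)
      (ivl_mono (EReal.coe_le_coe_iff.2 hye) le_rfl)) hv2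

theorem LimitPointB.memLp_N (hb : τ.LimitPointB) (hu : τ.IsSol lam (cx u))
    (hv : τ.IsSol lam (cx v)) (hW : ∀ x ∈ τ.I, τ.W (cx u) (cx v) x = 1) (hg : τ.DomTmax g)
    (hd : d ∈ τ.I) (h0 : ∀ x ∈ τ.I, d ≤ x → u x ≠ 0) :
    MemLp (τ.N u g) 2 (volume.restrict (ivl (d : EReal) τ.b)) := by
  rw [memLp_two_iff_integrable_sq_norm (aestronglyMeasurable_N hu.1.1 g (ivl_right_subset hd))]
  obtain ⟨M, hM⟩ := hb.exists_energy_le hu hv hW hg hd h0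
  refine integrableOn_right_of_bounded hd.2 M (fun y hy => ?_) ?_
  · have hyI := mem_I_of_ivl_right hd hy
    exact intervalIntegrable_norm_N_sq hu.1 hg.2.1 hd hyI
      (uIcc_ne_zero_right hd hyI h0 le_rfl (EReal.coe_lt_coe_iff.1 hy.1).le)
  · filter_upwards [eventually_mem_leftOf hd.2] with y hy
    simp only [norm_pow, norm_norm]
    exact hM y (mem_I_of_ivl_right hd hy) (EReal.coe_lt_coe_iff.1 hy.1).le

/-- If `u = o(v)` at `b` with `W(u,v) = 1`, then `v/u` tends to `∞` at `b`. -/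
theorem exists_le_div_sub_div (hu : τ.ACLoc (cx u)) (hv : τ.ACLoc (cx v))
    (hW : ∀ x ∈ τ.I, τ.W (cx u) (cx v) x = 1) (ho : u =o[leftOf τ.b] v) {e : ℝ}
    (he : e ∈ τ.I) (h0 : ∀ x ∈ τ.I, e ≤ x → u x ≠ 0) (S : ℝ) :
    ∃ y ∈ τ.I, e ≤ y ∧ S ≤ v y / u y - v e / u e := by
  have := neBot_leftOf τ.a_lt_b
  set K := |v e / u e| + |S| + 1 with hK
  have hK0 : 0 < K := by positivity
  obtain ⟨y, h1, hy⟩ := ((ho.bound (inv_pos.2 hK0)).and (eventually_mem_leftOf he.2)).exists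
  have hyI := mem_I_of_ivl_right he hy
  have hey := (EReal.coe_lt_coe_iff.1 hy.1).le
  refine ⟨y, hyI, hey, ?_⟩
  have hne := uIcc_ne_zero_right he hyI h0 le_rfl hey
  -- Smallness of `u` against `v` only makes `|v/u|` large; monotonicity of `v/u` rules out the
  -- negative sign.
  have h2 : 0 ≤ v y / u y - v e / u e := by
    rw [← integral_inv_p_sq hu hv hW he hyI hne]
    refine intervalIntegral.integral_nonneg_of_ae_restrict hey
      ((ae_restrict_iff' measurableSet_Icc).2 ?_)
    filter_upwards [ae_inv_p_sq_nonneg (τ := τ) u] with t ht ht'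
    rw [← uIcc_of_le hey] at ht'
    exact ht (uIcc_subset_I he hyI ht')
  have hu0 : 0 < |u y| := abs_pos.2 (hne y right_mem_uIcc)
  have h3 : K ≤ |v y / u y| := by
    rw [abs_div, le_div_iff₀ hu0, mul_comm]
    rwa [inv_mul_eq_div, le_div_iff₀ hK0] at h1
  have h4 := neg_abs_le (v e / u e)
  have h5 := le_abs_self (v e / u e)
  have h6 := le_abs_self S
  rcases abs_cases (v y / u y) with ⟨h, -⟩ | ⟨h, -⟩
  · linarith
  · linarith [abs_nonneg S]

/-- Integrated form of the weighted AM-GM bound; choosing `t = √s` makes it grow like `√s`. -/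
theorem norm_div_sub_div_le (hu : τ.ACLoc (cx u)) (hf : τ.ACLoc f) {α β s M t : ℝ}
    (hα : α ∈ τ.I) (hβ : β ∈ τ.I) (hαβ : α ≤ β) (h0 : ∀ x ∈ uIcc α β, u x ≠ 0) (ht : 0 < t)
    (hN : IntervalIntegrable (fun x => ‖τ.N u f x‖ ^ 2) volume α β)
    (hM : ∫ x in α..β, ‖τ.N u f x‖ ^ 2 ≤ M)
    (hs : ∫ x in α..β, (τ.p x)⁻¹ * (u x ^ 2)⁻¹ ≤ s) :
    ‖f β / (u β : ℂ) - f α / (u α : ℂ)‖ ≤ (t * M + t⁻¹ * s) / 2 := by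
  have hi := intervalIntegrable_inv_p_sq hu hα hβ h0
  rw [← (ACLoc.div hu hf hα hβ h0).complex_integral_deriv_eq_sub]
  have h1 : ‖∫ x in α..β, deriv (fun y => f y / (u y : ℂ)) x‖ ≤
      ∫ x in α..β, (t * ‖τ.N u f x‖ ^ 2 + t⁻¹ * ((τ.p x)⁻¹ * (u x ^ 2)⁻¹)) / 2 := by
    refine intervalIntegral.norm_integral_le_of_norm_le hαβ ?_
      (((hN.const_mul t).add (hi.const_mul t⁻¹)).div_const 2)
    filter_upwards [norm_deriv_div_le (τ := τ) u f ht] with x hx hx'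
    have hx'' := uIoc_subset_uIcc (by rwa [uIoc_of_le hαβ])
    exact hx (uIcc_subset_I hα hβ hx'') (h0 x hx'')
  refine h1.trans ?_
  rw [intervalIntegral.integral_div, intervalIntegral.integral_add (hN.const_mul t)
    (hi.const_mul t⁻¹), intervalIntegral.integral_const_mul, intervalIntegral.integral_const_mul]
  gcongr

/-- The boundary term at `b` vanishes for the principal solution. -/
theorem boundary_term_eq_zero (hu : τ.InD (cx u)) (hv : τ.ACLoc (cx v))
    (hW : ∀ x ∈ τ.I, τ.W (cx u) (cx v) x = 1) (ho : u =o[leftOf τ.b] v) (hf : τ.ACLoc f)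
    (hg : τ.InD g) (hd : d ∈ τ.I) (h0 : ∀ x ∈ τ.I, d ≤ x → u x ≠ 0)
    (hNf : MemLp (τ.N u f) 2 (volume.restrict (ivl (d : EReal) τ.b)))
    (hNg : MemLp (τ.N u g) 2 (volume.restrict (ivl (d : EReal) τ.b))) {L : ℂ}
    (hL : Tendsto (fun x => conj (f x / (u x : ℂ)) * τ.W (cx u) g x) (leftOf τ.b) (𝓝 L)) :
    L = 0 := by
  by_contra hL0
  have := neBot_leftOf τ.a_lt_b
  have hℓ : 0 < ‖L‖ / 2 := half_pos (norm_pos_iff.2 hL0)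
  set ℓ := ‖L‖ / 2 with hℓdef
  have hF := (memLp_two_iff_integrable_sq_norm hNf.1).1 hNf
  have hG := (memLp_two_iff_integrable_sq_norm hNg.1).1 hNg
  set Mf := ∫ x in ivl (d : EReal) τ.b, ‖τ.N u f x‖ ^ 2 with hMf
  have hMf0 : 0 ≤ Mf := integral_nonneg fun x => sq_nonneg _
  -- With weight `√S`, `|f/u| ≤ A + √S (Mf + 1)/2` on `[e,y]`, whence `|f/u|² ≤ S P` once `4 A² ≤ S
  -- P`. The point `e` is chosen with the remaining energy of `g` below `ℓ²/P`, and then `y` with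
  -- `S` large enough.
  set P := (Mf + 1) ^ 2 with hP
  have hP0 : 0 < P := by positivity
  have h1 : ∀ᶠ x in leftOf τ.b, ℓ < ‖conj (f x / (u x : ℂ)) * τ.W (cx u) g x‖ :=
    hL.norm.eventually (lt_mem_nhds (by rw [hℓdef]; linarith))
  have h2 : ∀ᶠ x in leftOf τ.b, (∫ x in ivl (d : EReal) τ.b, ‖τ.N u g x‖ ^ 2) - ℓ ^ 2 / P <
      ∫ t in d..x, ‖τ.N u g t‖ ^ 2 :=
    (tendsto_integral_leftOf hd.2 hG).eventually (lt_mem_nhds (by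
      have : 0 < ℓ ^ 2 / P := by positivity
      linarith))
  obtain ⟨e₀, he₀, h3⟩ := (eventually_leftOf τ.a_lt_b).1 h1
  obtain ⟨e, h4, hed, hee⟩ :=
    (h2.and ((eventually_mem_leftOf hd.2).and (eventually_mem_leftOf he₀.2))).exists
  have heI := mem_I_of_ivl_right hd hed
  have hde := (EReal.coe_lt_coe_iff.1 hed.1).le
  have h0e : ∀ x ∈ τ.I, e ≤ x → u x ≠ 0 := fun x hx hex => h0 x hx (hde.trans hex)
  set A := ‖f e / (u e : ℂ)‖ with hA
  obtain ⟨y, hyI, hey, hS⟩ := exists_le_div_sub_div hu.1 hv hW ho heI h0e (4 * A ^ 2 / P + 1)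
  have hne := uIcc_ne_zero_right heI hyI h0e le_rfl hey
  set S := v y / u y - v e / u e with hSdef
  have hS0 : 0 < S := lt_of_lt_of_le (by positivity) hS
  have hSint : ∫ x in e..y, (τ.p x)⁻¹ * (u x ^ 2)⁻¹ = S := integral_inv_p_sq hu.1 hv hW heI hyI hne
  have hSA : 4 * A ^ 2 ≤ S * P := by
    have : 4 * A ^ 2 / P ≤ S := by linarith
    rwa [div_le_iff₀ hP0] at this
  have hκ := intervalIntegrable_inv_p_sq hu.1 heI hyI hne
  have hGe := intervalIntegrable_norm_N_sq hu hg heI hyI hne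
  have hψ : ∀ t ∈ Icc e y, ‖f t / (u t : ℂ)‖ ^ 2 ≤ S * P := by
    intro t ht
    have htI : t ∈ τ.I := uIcc_subset_I heI hyI (by rwa [uIcc_of_le hey])
    have hne' := uIcc_ne_zero_right heI htI h0e le_rfl ht.1
    have hNt : IntervalIntegrable (fun x => ‖τ.N u f x‖ ^ 2) volume e t := by
      refine (intervalIntegrable_iff_integrableOn_Ioc_of_le ht.1).2 (IntegrableOn.mono_set hF ?_)
      exact fun x hx => ⟨EReal.coe_lt_coe_iff.2 (hde.trans_lt hx.1),
        (EReal.coe_le_coe_iff.2 hx.2).trans_lt htI.2⟩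
    have hs : ∫ x in e..t, (τ.p x)⁻¹ * (u x ^ 2)⁻¹ ≤ S := by
      rw [← hSint]
      refine intervalIntegral.integral_mono_interval le_rfl ht.1 ht.2 ?_ hκ
      refine (ae_restrict_iff' measurableSet_Ioc).2 ?_
      filter_upwards [ae_inv_p_sq_nonneg (τ := τ) u] with x hx hx'
      exact hx (uIcc_subset_I heI hyI (uIoc_subset_uIcc (by rwa [uIoc_of_le hey])))
    have h5 := norm_div_sub_div_le hu.1 hf heI htI ht.1 hne' (Real.sqrt_pos.2 hS0) hNt
      (intervalIntegral_le_of_integrableOn_right (fun x => sq_nonneg _) hF hde ht.1 htI.2) hs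
    have h6 : (√S)⁻¹ * S = √S := by
      have h7 := Real.mul_self_sqrt hS0.le
      have h8 := (Real.sqrt_pos.2 hS0).ne'
      field_simp
      nlinarith
    rw [h6] at h5
    have h7 : ‖f t / (u t : ℂ)‖ ≤ A + √S * (Mf + 1) / 2 := by
      have := norm_sub_norm_le (f t / (u t : ℂ)) (f e / (u e : ℂ))
      linarith
    have h8 : (√S * (Mf + 1)) ^ 2 = S * P := by rw [mul_pow, Real.sq_sqrt hS0.le]
    calc _ ≤ (A + √S * (Mf + 1) / 2) ^ 2 := pow_le_pow_left₀ (norm_nonneg _) h7 2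
      _ ≤ 2 * A ^ 2 + (√S * (Mf + 1)) ^ 2 / 2 := by
          nlinarith [sq_nonneg (A - √S * (Mf + 1) / 2)]
      _ ≤ S * P := by rw [h8]; linarith
  -- Pointwise, `ℓ² ≤ |f/u|² |W(u,g)|² ≤ S P |W(u,g)|²`. Integrating against `1/(p u²)` gives `ℓ² S
  -- ≤ S P ∫ |N_u g|²`, which is less than `ℓ² S` by the choice of `e`.
  have h9 : ∫ x in e..y, ℓ ^ 2 * ((τ.p x)⁻¹ * (u x ^ 2)⁻¹) ≤
      ∫ x in e..y, S * P * ‖τ.N u g x‖ ^ 2 := by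
    refine intervalIntegral.integral_mono_ae_restrict hey (hκ.const_mul _) (hGe.const_mul _)
      ((ae_restrict_iff' measurableSet_Icc).2 ?_)
    filter_upwards [ae_inv_p_sq_nonneg (τ := τ) u, norm_N_sq_ae_eq hu.1 hg.1] with t h5 h6 ht
    have ht' : t ∈ uIcc e y := by rwa [uIcc_of_le hey]
    have htI := uIcc_subset_I heI hyI ht'
    rw [h6 htI (hne t ht')]
    have h7 : ℓ ^ 2 ≤ S * P * ‖τ.W (cx u) g t‖ ^ 2 := by
      have h8 := h3 t (mem_ivl_right htI ((EReal.coe_lt_coe_iff.1 hee.1).trans_le ht.1))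
      rw [norm_mul, RCLike.norm_conj] at h8
      calc ℓ ^ 2 ≤ (‖f t / (u t : ℂ)‖ * ‖τ.W (cx u) g t‖) ^ 2 := pow_le_pow_left₀ hℓ.le h8.le 2
        _ = ‖f t / (u t : ℂ)‖ ^ 2 * ‖τ.W (cx u) g t‖ ^ 2 := mul_pow _ _ _
        _ ≤ _ := mul_le_mul_of_nonneg_right (hψ t ht) (sq_nonneg _)
    have := mul_le_mul_of_nonneg_left h7 (h5 htI)
    linarith
  rw [intervalIntegral.integral_const_mul, intervalIntegral.integral_const_mul, hSint] at h9
  have h10 : ∫ x in e..y, ‖τ.N u g x‖ ^ 2 < ℓ ^ 2 / P := by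
    have h11 := intervalIntegral_le_of_integrableOn_right (fun x => sq_nonneg _) hG le_rfl
      (hde.trans hey) hyI.2
    rw [← intervalIntegral.integral_add_adjacent_intervals
      (intervalIntegrable_norm_N_sq hu hg hd heI (uIcc_ne_zero_right hd heI h0 le_rfl hde)) hGe]
      at h11
    linarith
  have h12 := mul_lt_mul_of_pos_left h10 (mul_pos hS0 hP0)
  have h13 : S * P * (ℓ ^ 2 / P) = ℓ ^ 2 * S := by field_simp
  linarith

/-- Green's formula up to the endpoint `b`, for the principal solution. -/
theorem integral_conj_N_mul_N_right (hu : τ.IsPrincipalB lam u) (hf : τ.ACLoc f)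
    (hf2 : τ.InL2 f) (hg : τ.DomTmax g) (hd : d ∈ τ.I) (h0 : ∀ x ∈ τ.I, d ≤ x → u x ≠ 0)
    (hNf : MemLp (τ.N u f) 2 (volume.restrict (ivl (d : EReal) τ.b)))
    (hNg : MemLp (τ.N u g) 2 (volume.restrict (ivl (d : EReal) τ.b))) :
    ∫ x in ivl (d : EReal) τ.b, conj (τ.N u f x) * τ.N u g x =
      -(conj (f d / (u d : ℂ)) * τ.W (cx u) g d)
      + ∫ x in ivl (d : EReal) τ.b,
          (τ.r x : ℂ) * (conj (f x) * (τ.apply g x - lam * g x)) := by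
  obtain ⟨hus, v, hv, hW, ho, -⟩ := hu
  have h1 := tendsto_integral_leftOf hd.2 (integrableOn_conj_N_mul_N hNf hNg)
  have h2 := tendsto_integral_leftOf hd.2
    ((hf2.integrableOn (hg.inL2_sub lam)).mono_set (ivl_right_subset hd))
  have h3 := (h1.sub h2).add_const (conj (f d / (u d : ℂ)) * τ.W (cx u) g d)
  -- Green's formula on `[d,y]` shows that the boundary product converges, although its two factors
  -- need not converge separately.
  have h4 := boundary_term_eq_zero hus.1 hv.1.1 hW ho hf hg.2.1 hd h0 hNf hNg (h3.congr' (by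
    filter_upwards [eventually_mem_leftOf hd.2] with y hy
    have hyI := mem_I_of_ivl_right hd hy
    rw [integral_conj_N_mul_N hus hf hg.2.1 hd hyI
      (uIcc_ne_zero_right hd hyI h0 le_rfl (EReal.coe_lt_coe_iff.1 hy.1).le)]
    ring))
  linear_combination h4

end RightEndpoint

/-! ### The middle interval and the assembly of the form -/

/-- The square of the norm is `|g^[1]|²/p`, with `g^[1]` continuous on `[c,d]` and `1/p` integrable
there. -/
theorem memLp_inv_sqrt_mul_qd {g : ℝ → ℂ} (hg : τ.InD g) {c d : ℝ} (hc : c ∈ τ.I) (hd : d ∈ τ.I)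
    (hcd : c ≤ d) : MemLp (fun x => ((Real.sqrt (τ.p x))⁻¹ : ℂ) * τ.qd g x) 2
      (volume.restrict (Set.Ioo c d)) := by
  have hsub : Ioo c d ⊆ uIcc c d := by rw [uIcc_of_le hcd]; exact Ioo_subset_Icc_self
  have hsI := hsub.trans (uIcc_subset_I hc hd)
  have hm : AEStronglyMeasurable (fun x => ((Real.sqrt (τ.p x))⁻¹ : ℂ) * τ.qd g x)
      (volume.restrict (Ioo c d)) := by
    refine AEStronglyMeasurable.mono_set hsI (AEStronglyMeasurable.mul ?_
      (hg.2.continuousOn.aestronglyMeasurable measurableSet_I))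
    exact (Complex.measurable_ofReal.comp_aemeasurable
      (Real.continuous_sqrt.measurable.comp_aemeasurable τ.p_meas)).inv.aestronglyMeasurable
  rw [memLp_two_iff_integrable_sq_norm hm]
  have hi := (intervalIntegrable_p_inv hc hd).mul_continuousOn
    (((hg.2 c hc d hd).continuousOn.norm).pow 2)
  refine (((intervalIntegrable_iff_integrableOn_Ioc_of_le hcd).1 hi).mono_set
    Ioo_subset_Ioc_self).congr ((ae_restrict_iff' measurableSet_Ioo).2 ?_)
  filter_upwards [τ.ae_p_pos] with x hp hx
  rw [norm_mul, norm_inv, Complex.norm_real, Real.norm_eq_abs, mul_pow, inv_pow, sq_abs,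
    Real.sq_sqrt (hp (hsI hx)).le]
  rfl

theorem setIntegral_I_eq_add {F : ℝ → ℂ} (hF : IntegrableOn F τ.I) {c d : ℝ} (hc : c ∈ τ.I)
    (hd : d ∈ τ.I) (hcd : c ≤ d) :
    ∫ x in τ.I, F x = (∫ x in ivl τ.a (c : EReal), F x) + (∫ x in c..d, F x)
      + ∫ x in ivl (d : EReal) τ.b, F x := by
  have hIcc : Icc c d ⊆ τ.I := by rw [← uIcc_of_le hcd]; exact uIcc_subset_I hc hd
  have e1 : τ.I = (ivl τ.a (c : EReal) ∪ Icc c d) ∪ ivl (d : EReal) τ.b := by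
    ext x
    constructor
    · intro hx
      rcases lt_or_ge x c with h | h
      · exact Or.inl (Or.inl ⟨hx.1, EReal.coe_lt_coe_iff.2 h⟩)
      · rcases le_or_gt x d with h' | h'
        · exact Or.inl (Or.inr ⟨h, h'⟩)
        · exact Or.inr ⟨EReal.coe_lt_coe_iff.2 h', hx.2⟩
    · rintro ((h | h) | h)
      · exact ivl_left_subset hc h
      · exact hIcc h
      · exact ivl_right_subset hd h
  have d1 : Disjoint (ivl τ.a (c : EReal)) (Icc c d) :=
    disjoint_left.2 fun x h h' => (EReal.coe_lt_coe_iff.1 h.2).not_ge h'.1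
  have d2 : Disjoint (ivl τ.a (c : EReal) ∪ Icc c d) (ivl (d : EReal) τ.b) := by
    refine disjoint_left.2 fun x h h' => ?_
    have h2 := EReal.coe_lt_coe_iff.1 h'.1
    rcases h with h | h
    · exact absurd (EReal.coe_lt_coe_iff.1 h.2) (by linarith)
    · exact h2.not_ge h.2
  have i1 := hF.mono_set (ivl_left_subset hc)
  have i2 := hF.mono_set hIcc
  rw [e1, setIntegral_union d2 (measurableSet_ivl _ _) (i1.union i2)
    (hF.mono_set (ivl_right_subset hd)), setIntegral_union d1 measurableSet_Icc i1 i2,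
    integral_Icc_eq_integral_Ioc, ← intervalIntegral.integral_of_le hcd]

end Expr

end SturmLiouville

theorem lemma4p3 (τ : SturmLiouville.Expr) (lam : ℝ) (ua va ub vb : ℝ → ℝ)
    (hyp : τ.Hyp lam ua va ub vb)
    (a₀ b₀ c d : ℝ)
    (ha₀ : τ.a < (a₀ : EReal)) (hab₀ : a₀ < b₀) (hb₀ : (b₀ : EReal) < τ.b)
    (hnza : ∀ x : ℝ, τ.a < (x : EReal) → x < a₀ → ua x ≠ 0 ∧ va x ≠ 0)
    (hnzb : ∀ x : ℝ, b₀ < x → (x : EReal) < τ.b → ub x ≠ 0 ∧ vb x ≠ 0)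
    (hac : τ.a < (c : EReal)) (hca₀ : c < a₀) (hbd : b₀ < d) (hdb : (d : EReal) < τ.b)
    (f g : ℝ → ℂ) (hf : τ.DomQ va ub c d f) (hg : τ.DomTmax g) :
    τ.DomQ va ub c d g ∧
    Tendsto (fun x => f x / (va x : ℂ)) (SturmLiouville.rightOf τ.a) (𝓝 (τ.bv va f)) ∧
    Tendsto (τ.W (SturmLiouville.Expr.cx va) g) (SturmLiouville.rightOf τ.a)
      (𝓝 (τ.bv' va g)) ∧
    τ.innerR f (τ.apply g) = τ.Q lam va ub c d f g + conj (τ.bv va f) * τ.bv' va g := by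
  open SturmLiouville Expr in
  have hcd : c < d := by linarith
  have hc : c ∈ τ.I := ⟨hac, (EReal.coe_lt_coe_iff.2 hcd).trans hdb⟩
  have hd : d ∈ τ.I := ⟨hac.trans (EReal.coe_lt_coe_iff.2 hcd), hdb⟩
  have h0a : ∀ x ∈ τ.I, x ≤ c → va x ≠ 0 := fun x hx h => (hnza x hx.1 (h.trans_lt hca₀)).2
  have h0b : ∀ x ∈ τ.I, d ≤ x → ub x ≠ 0 := fun x hx h => (hnzb x (hbd.trans_le h) hx.2).1
  have hva := hyp.nonprincipal_a.1
  have hub := hyp.principal_b.1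
  obtain ⟨hf2, hfac, -, hNfa, hNfb⟩ := hf
  have hint := hyp.principal_a.integrableOn_inv_p_sq hva hyp.wronskian_a hc h0a
  have hB := tendsto_nhds_limUnder (hyp.limitCircle.exists_tendsto_W hva hg)
  have hA := tendsto_nhds_limUnder (exists_tendsto_div_rightOf hva.1.1 hfac hc h0a hint hNfa)
  obtain ⟨C, hC⟩ := exists_bound_of_tendsto_rightOf (hva.1.acLoc_W hg.2.1).continuousOn hB hc
  have hNga : MemLp (τ.N va g) 2 (volume.restrict (ivl τ.a (c : EReal))) :=
    memLp_N_of_bounded hva.1.1 hg.2.1.1 (measurableSet_ivl _ _) (ivl_left_subset hc)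
      (fun x hx => h0a x (ivl_left_subset hc hx) (EReal.coe_lt_coe_iff.1 hx.2).le) hint C hC
  have hNgb : MemLp (τ.N ub g) 2 (volume.restrict (ivl (d : EReal) τ.b)) := by
    obtain ⟨-, w, hw, hW, -⟩ := hyp.principal_b
    exact hyp.limitPoint.memLp_N hub hw hW hg hd h0b
  refine ⟨⟨hg.1, hg.2.1.1, memLp_inv_sqrt_mul_qd hg.2.1 hc hd hcd.le, hNga, hNgb⟩, hA, hB, ?_⟩
  have hL := integral_conj_N_mul_N_left hva hfac hf2 hg hc h0a hNfa hNga hA hB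
  have hR := integral_conj_N_mul_N_right hyp.principal_b hfac hf2 hg hd h0b hNfb hNgb
  have hM := integral_r_conj_mul_apply hfac hg.2.1 hc hd
  have i1 := hf2.integrableOn hg.2.2
  have i2 := hf2.integrableOn hg.1
  -- The Green formulas pair `f` with `τ g - λ₀ g`; splitting off `λ₀ g` produces the two `λ₀`
  -- integrals of the form.
  have hsplit : ∀ s ⊆ τ.I, ∫ x in s, (τ.r x : ℂ) * (conj (f x) * (τ.apply g x - lam * g x)) =
      (∫ x in s, (τ.r x : ℂ) * (conj (f x) * τ.apply g x))
        - lam * ∫ x in s, (τ.r x : ℂ) * (conj (f x) * g x) := by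
    intro s hs
    rw [← integral_const_mul, ← integral_sub (i1.mono_set hs) ((i2.mono_set hs).const_mul _)]
    congr 1
    ext x
    ring
  rw [hsplit _ (ivl_left_subset hc)] at hL
  rw [hsplit _ (ivl_right_subset hd)] at hR
  have hva0 : (va c : ℂ) ≠ 0 := by exact_mod_cast h0a c hc le_rfl
  have hub0 : (ub d : ℂ) ≠ 0 := by exact_mod_cast h0b d hd le_rfl
  -- Expanding the Wronskian separates `conj f g^[1]`, which cancels against the boundary term of
  -- the middle interval, from the point term of `Q`; the same happens at `d`.
  have eL : conj (f c / (va c : ℂ)) * τ.W (cx va) g c =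
      conj (f c) * τ.qd g c - τ.qd (cx va) c / (va c : ℂ) * (conj (f c) * g c) := by
    simp only [W, cx, map_div₀, Complex.conj_ofReal]
    field_simp
  have eR : conj (f d / (ub d : ℂ)) * τ.W (cx ub) g d =
      conj (f d) * τ.qd g d - τ.qd (cx ub) d / (ub d : ℂ) * (conj (f d) * g d) := by
    simp only [W, cx, map_div₀, Complex.conj_ofReal]
    field_simp
  unfold innerR Q
  rw [setIntegral_I_eq_add i1 hc hd hcd.le, ← integral_Ioc_eq_integral_Ioo,
    ← intervalIntegral.integral_of_le hcd.le]
  rw [eL] at hL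
  rw [eR] at hR
  unfold bv bv'
  linear_combination hM - hL - hR
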